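/- Let $P\in\mathbb C[z]$ be a polynomial of degree $d\ge 2$ such that both $P$ and $P'$ have only simple roots, and let $\alpha$ be a real number with $0<\alpha<d$. Let $\Lambda\subset\mathbb C_z\times\mathbb C_W$ be the affine curve $$\sum_{k=0}^{d}\frac{\alpha-k}{k!}\,P^{(k)}(z)\,W^{d-k}=0,$$ let $\widehat\Lambda$ be its closure in $\mathbb{CP}^1_z\times\mathbb{CP}^1_W$, let $\mathfrak n:\widetilde\Lambda\to\widehat\Lambda$ be the normalisation (so $\widetilde\Lambda$ is a compact Riemann surface), and let $\widetilde\Omega=\mathfrak n^*(W\,dz)$, a meromorphic $1$-form on $\widetilde\Lambda$. An irreducible affine plane curve is called an affine Boutroux curve if the integrals of the form $W\,dz$, pulled back to the normalisation of its closure in $\mathbb{CP}^1\times\mathbb{CP}^1$, over all closed loops avoiding the poles are purely imaginary. Then $\Lambda$ is an affine Boutroux curve. More exactly: (i) $\Lambda$ is an irreducible rational curve (its defining polynomial is irreducible), and $\widetilde\Lambda\cong\mathbb{CP}^1$. (ii) The only point of $\widehat\Lambda$ with $z=\infty$ is $(\infty,0)$. (iii) In the coordinates $(y,W)$ with $y=1/z$,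 the equation of the slopes $s$ (tangent lines $W=sy$) of $\widehat\Lambda$ at $(\infty,0)$ is, up to a nonzero constant factor, $(s+1)^{d-1}(\alpha(s+1)-d)=0$. It has exactly two distinct solutions: $s=\frac d\alpha-1$, which is simple, and $s=-1$, of multiplicity $d-1$. (iv) The only singular point of $\widehat\Lambda$ is $(\infty,0)$; $\mathfrak n$ is one-to-one over all other points of $\widehat\Lambda$, and the preimage of $(\infty,0)$ consists of $d$ points. (v) The $d$ local branches of $\widehat\Lambda$ at $(\infty,0)$, which correspond to these $d$ points, are all smooth; one of them has slope $\frac d\alpha-1$ and the other $d-1$ have slope $-1$. (vi) Over each of the $d$ points $(z_i,\infty)$, where $z_i$ runs over the roots of $P$, there is exactly one point $p_i\in\widetilde\Lambda$, and the residue of $\widetilde\Omega$ at $p_i$ is $\frac{1-\alpha}{\alpha}$. If $\alpha\ne1$, then $\widetilde\Omega$ has a simple pole at $p_i$; if $\alpha=1$, then $\widetilde\Omega$ has no pole at $p_i$. (vii) $\widetilde\Omega$ has a simple pole at each of the $d$ points over $(\infty,0)$; its residue is $1$ at each of the $d-1$ points that correspond to the branches of slope $-1$, and $\frac{\alpha-d}{\alpha}$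 at the point that corresponds to the branch of slope $\frac d\alpha-1$. The poles listed in (vi) and (vii) are all the poles of $\widetilde\Omega$. -/

import Mathlib

open Polynomial Filter Topology Manifold
open scoped ContDiff Polynomial.Bivariate

noncomputable section
/-! ### The Riemann sphere `OnePoint ℂ` as a complex manifold -/

namespace RiemannSphere

/-- The inversion `z ↦ 1 / z` of the Riemann sphere, exchanging `0` and `∞`. -/
def inv : OnePoint ℂ → OnePoint ℂ
  | none => ((0 : ℂ) : OnePoint ℂ)
  | some z => if z = 0 then OnePoint.infty else ((z⁻¹ : ℂ) : OnePoint ℂ)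

theorem inv_infty : inv OnePoint.infty = ((0 : ℂ) : OnePoint ℂ) := rfl

theorem inv_coe (z : ℂ) :
    inv (z : OnePoint ℂ) = if z = 0 then OnePoint.infty else ((z⁻¹ : ℂ) : OnePoint ℂ) := rfl

theorem inv_involutive : Function.Involutive inv := by
  intro x
  induction x using OnePoint.rec with
  | infty => simp [inv_infty, inv_coe]
  | coe z => by_cases h : z = 0 <;> simp [inv_infty, inv_coe, h]

theorem continuous_inv : Continuous inv := by
  rw [continuous_iff_continuousAt]
  intro x
  induction x using OnePoint.rec with
  | infty =>
    rw [OnePoint.continuousAt_infty', inv_infty, coclosedCompact_eq_cocompact,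
      ← Metric.cobounded_eq_cocompact]
    have h : Tendsto (fun z : ℂ => ((z⁻¹ : ℂ) : OnePoint ℂ)) (Bornology.cobounded ℂ)
        (𝓝 ((0 : ℂ) : OnePoint ℂ)) :=
      (OnePoint.continuous_coe.tendsto 0).comp tendsto_inv₀_cobounded
    refine h.congr' ?_
    filter_upwards [Bornology.eventually_ne_cobounded (0 : ℂ)] with z hz
    simp [inv_coe, hz]
  | coe z =>
    rw [OnePoint.continuousAt_coe]
    by_cases hz : z = 0
    · subst hz
      rw [← continuousWithinAt_compl_self]
      have h : Tendsto (fun z : ℂ => ((z⁻¹ : ℂ) : OnePoint ℂ)) (𝓝[≠] 0)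
          (𝓝 (OnePoint.infty : OnePoint ℂ)) := by
        have h1 : Tendsto ((↑) : ℂ → OnePoint ℂ) (Bornology.cobounded ℂ) (𝓝 OnePoint.infty) := by
          rw [OnePoint.nhds_infty_eq, coclosedCompact_eq_cocompact,
            ← Metric.cobounded_eq_cocompact]
          exact tendsto_map.mono_right le_sup_left
        exact h1.comp tendsto_inv₀_nhdsNE_zero
      have h2 : (inv ∘ ((↑) : ℂ → OnePoint ℂ)) 0 = OnePoint.infty := by simp [inv_coe]
      rw [ContinuousWithinAt, h2]
      refine h.congr' ?_
      filter_upwards [self_mem_nhdsWithin] with z hz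
      have hz' : z ≠ 0 := hz
      simp [inv_coe, hz']
    · have h : ContinuousAt (fun z : ℂ => ((z⁻¹ : ℂ) : OnePoint ℂ)) z :=
        OnePoint.continuous_coe.continuousAt.comp (continuousAt_inv₀ hz)
      refine h.congr ?_
      filter_upwards [isOpen_ne.mem_nhds hz] with w hw
      have hw' : w ≠ 0 := hw
      simp [inv_coe, hw']

/-- The inversion as a homeomorphism. -/
def invHomeomorph : OnePoint ℂ ≃ₜ OnePoint ℂ where
  toEquiv := inv_involutive.toPerm inv
  continuous_toFun := continuous_inv
  continuous_invFun := continuous_inv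

/-- The coordinate `z` on the complement of `∞`. -/
def finiteChart : OpenPartialHomeomorph (OnePoint ℂ) ℂ :=
  (OnePoint.isOpenEmbedding_coe.toOpenPartialHomeomorph ((↑) : ℂ → OnePoint ℂ)).symm

/-- The coordinate `1 / z` on the complement of `0`. -/
def inftyChart : OpenPartialHomeomorph (OnePoint ℂ) ℂ :=
  invHomeomorph.toOpenPartialHomeomorph.trans finiteChart

open Classical in
instance : ChartedSpace ℂ (OnePoint ℂ) where
  atlas := {finiteChart, inftyChart}
  chartAt x := if x = OnePoint.infty then inftyChart else finiteChart
  mem_chart_source x := by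
    induction x using OnePoint.rec with
    | infty => simpa [inftyChart, finiteChart] using ⟨(0 : ℂ), rfl⟩
    | coe z => simp [finiteChart]
  chart_mem_atlas x := by split_ifs <;> simp

/-- The value of the standard coordinate vanishing or finite at `x`: `z` itself at a finite point
`z`, and `1 / z = 0` at `∞`. -/
def coord : OnePoint ℂ → ℂ
  | none => 0
  | some z => z

end RiemannSphere

/-! ### Plane curves and their closures in the product of two Riemann spheres

A bivariate polynomial `F : ℂ[X][Y]` is evaluated at `(z, w)` by `F.evalEval z w`; the inner
variable is `z`, the outer one is `w`. -/

/-- The product of two Riemann spheres, with coordinates `(z, w)`. -/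
abbrev SphereSq : Type := OnePoint ℂ × OnePoint ℂ

/-- The closure in the product of two Riemann spheres of the affine curve `F = 0`. -/
def curveClosure (F : ℂ[X][Y]) : Set SphereSq :=
  closure {p | ∃ z w : ℂ, F.evalEval z w = 0 ∧ p = ((z : OnePoint ℂ), (w : OnePoint ℂ))}

open Classical in
/-- The polynomial equation of the closure in the standard affine chart at `p`: the coordinate `z`
is replaced by `1 / z` if `p.1 = ∞`, the coordinate `w` by `1 / w` if `p.2 = ∞`, and denominators
are cleared. -/
def localEquation (F : ℂ[X][Y]) (p : SphereSq) : ℂ[X][Y] :=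
  let G := if p.2 = OnePoint.infty then F.reverse else F
  if p.1 = OnePoint.infty then Bivariate.swap (Bivariate.swap G).reverse else G

/-- The singular points of the closure of the (reduced) curve `F = 0`: both partial derivatives of
the local equation vanish. -/
def singularPoints (F : ℂ[X][Y]) : Set SphereSq :=
  {p | p ∈ curveClosure F ∧
    fderiv ℂ (fun x : ℂ × ℂ => (localEquation F p).evalEval x.1 x.2)
      (RiemannSphere.coord p.1, RiemannSphere.coord p.2) = 0}

/-- The irreducible curve `F = 0` is rational: its function field is purely transcendental of
degree one over `ℂ`. -/
def IsRationalCurve (F : ℂ[X][Y]) : Prop :=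
  Irreducible F ∧
    Nonempty (FractionRing (ℂ[X][Y] ⧸ Ideal.span {F}) ≃ₐ[ℂ] RatFunc ℂ)

/-- `q` is the slope polynomial of the plane curve germ `G = 0` at the origin, where `G` vanishes
to order `m`: the terms of lowest degree `m` of `G (y, w)`, restricted to the line `w = s y`, are
`y ^ m * q (s)`. -/
def HasSlopePolynomial (G : ℂ[X][Y]) (m : ℕ) (q : ℂ[X]) : Prop :=
  q ≠ 0 ∧ ∃ R : ℂ[X][Y], ∀ y s : ℂ,
    G.evalEval y (s * y) = y ^ m * (q.eval s + y * R.evalEval y s)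

/-! ### Normalisation, and the form `w dz` on it -/

section Normalisation

variable {M : Type} [TopologicalSpace M] [ChartedSpace ℂ M]

/-- `ν : M → ℂP¹ × ℂP¹` is the normalisation of the closure of the curve `F = 0`: `M` is a compact
connected Riemann surface, and `ν` is holomorphic, maps `M` onto the closure, and is injective away
from finitely many points. -/
structure IsNormalisation (F : ℂ[X][Y]) (ν : M → SphereSq) : Prop where
  isManifold : IsManifold 𝓘(ℂ) ω M
  compact : CompactSpace M
  t2 : T2Space M
  connected : ConnectedSpace M
  holomorphic_fst : MDifferentiable 𝓘(ℂ) 𝓘(ℂ) (fun p => (ν p).1)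
  holomorphic_snd : MDifferentiable 𝓘(ℂ) 𝓘(ℂ) (fun p => (ν p).2)
  range_eq : Set.range ν = curveClosure F
  finite_nonInjective : {p | ∃ q, q ≠ p ∧ ν q = ν p}.Finite

/-- The coefficient `h` of the pullback `ν^*(w dz) = h(t) dt` in the preferred chart at `p`. It is
meaningful on a punctured neighbourhood of the point `t = chartAt ℂ p p`. -/
def formCoeff (ν : M → SphereSq) (p : M) (t : ℂ) : ℂ :=
  RiemannSphere.coord (ν ((chartAt ℂ p).symm t)).2 *
    deriv (fun s => RiemannSphere.coord (ν ((chartAt ℂ p).symm s)).1) t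

/-- The order at `p` of the meromorphic form `ν^*(w dz)`. -/
def formOrder (ν : M → SphereSq) (p : M) : WithTop ℤ :=
  meromorphicOrderAt (formCoeff ν p) (chartAt ℂ p p)

/-- The residue of `ν^*(w dz)` at `p` is `r`. -/
def HasFormResidue (ν : M → SphereSq) (p : M) (r : ℂ) : Prop :=
  ∀ᶠ ε in 𝓝[>] (0 : ℝ),
    (2 * Real.pi * Complex.I)⁻¹ * (∮ t in C(chartAt ℂ p p, ε), formCoeff ν p t) = r

/-- The value at `p` of `ν^*(w dz)`, where it has no pole, on the unit tangent vector of the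
preferred chart at `p`. -/
def formValue (ν : M → SphereSq) (p : M) : ℂ :=
  limUnder (𝓝[≠] (chartAt ℂ p p)) (formCoeff ν p)

/-- The integral of `ν^*(w dz)` over a `C¹` path parametrised by `[0, 1]`. -/
def formIntegral (ν : M → SphereSq) (γ : ℝ → M) : ℂ :=
  ∫ t in (0 : ℝ)..1, formValue ν (γ t) *
    (show ℂ from mfderivWithin 𝓘(ℝ, ℝ) 𝓘(ℝ, ℂ) γ (Set.Icc 0 1) t (1 : ℝ))

/-- The form `ν^*(w dz)` has purely imaginary periods: its integrals over all closed `C¹` loops that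
avoid its poles are purely imaginary. (Such loops generate the first homology group.) -/
def HasImaginaryPeriods (ν : M → SphereSq) : Prop :=
  ∀ γ : ℝ → M, ContMDiffOn 𝓘(ℝ, ℝ) 𝓘(ℝ, ℂ) 1 γ (Set.Icc 0 1) → γ 0 = γ 1 →
    (∀ t ∈ Set.Icc (0 : ℝ) 1, 0 ≤ formOrder ν (γ t)) → (formIntegral ν γ).re = 0

/-- The local branch at `(∞, 0)` parametrised by `ν` near `p` is smooth with slope `s`: as a germ
of sets it is the graph `w = f(y)` of a holomorphic function of the coordinate `y = 1 / z`, with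
`f(0) = 0` and `f'(0) = s`. -/
def IsSmoothBranchAtInfty (ν : M → SphereSq) (p : M) (s : ℂ) : Prop :=
  ∃ f : ℂ → ℂ, AnalyticAt ℂ f 0 ∧ f 0 = 0 ∧ deriv f 0 = s ∧
    map ν (𝓝 p) =
      map (fun y : ℂ => (RiemannSphere.inv (y : OnePoint ℂ), ((f y : ℂ) : OnePoint ℂ))) (𝓝 0)

end Normalisation

/-- The affine curve `F = 0` is an affine Boutroux curve: it is irreducible and the form `w dz` has
purely imaginary periods on the normalisation of its closure. -/
def IsAffineBoutroux (F : ℂ[X][Y]) : Prop :=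
  Irreducible F ∧
    ∃ (M : Type) (_ : TopologicalSpace M) (_ : ChartedSpace ℂ M) (ν : M → SphereSq),
      IsNormalisation F ν ∧ HasImaginaryPeriods ν

/-! ### The scaled symbol curve -/

/-- Both `P` and its derivative have only simple roots. -/
def StronglyGeneric (P : ℂ[X]) : Prop :=
  P.roots.Nodup ∧ (derivative P).roots.Nodup

/-- The polynomial `∑ k ≤ d, (α - k) / k! * P^(k)(z) * w ^ (d - k)` with `d = deg P`. -/
def scaledSymbol (P : ℂ[X]) (α : ℝ) : ℂ[X][Y] :=
  ∑ k ∈ Finset.range (P.natDegree + 1),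
    C (C (((α : ℂ) - k) / (k.factorial : ℂ)) * derivative^[k] P) * X ^ (P.natDegree - k)

end

/-!
If `w ≠ 0` and `u = z + 1 / w`, Taylor's formula turns the equation of the curve into
`w ^ (d - 1) * (α w P(u) - P'(u)) = 0`. So `u` is a global parameter: `z = u - α P(u) / P'(u)` and
`w = P'(u) / (α P(u))`, and the coordinate ring is `ℂ[u]` with `P P'` inverted. In this parameter
`w dz = ((1 - α) / α * P' / P + P'' / P') du` is a real combination of logarithmic derivatives, so
its residues are weighted orders of vanishing of `P` and `P'`, and
`Re ∫ w dz = (1 - α) / α * log |P| + log |P'|` is single valued.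
-/

/-! ### Taylor's formula for the scaled symbol -/

section Taylor

variable {K A : Type*} [Field K] [CharZero K] [CommRing A] [Algebra K A]

theorem aeval_add_eq_sum_iterate_derivative (P : K[X]) (z t : A) {n : ℕ} (hn : P.natDegree < n) :
    aeval (z + t) P = ∑ k ∈ Finset.range n,
      algebraMap K A (k.factorial : K)⁻¹ * aeval z (derivative^[k] P) * t ^ k := by
  have hdeg : (taylor z (P.map (algebraMap K A))).natDegree < n := by
    rw [natDegree_taylor]
    exact natDegree_map_le.trans_lt hn
  rw [aeval_def, ← eval_map, add_comm, ← taylor_eval, eval_eq_sum_range' hdeg]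
  refine Finset.sum_congr rfl fun k _ => ?_
  have hderiv : aeval z (derivative^[k] P) =
      (k.factorial : A) * (hasseDeriv k (P.map (algebraMap K A))).eval z := by
    rw [aeval_def, ← eval_map, ← iterate_derivative_map, ← factorial_smul_hasseDeriv]
    simp
  have hfact : algebraMap K A (k.factorial : K)⁻¹ * (k.factorial : A) = 1 := by
    rw [← map_natCast (algebraMap K A), ← map_mul,
      inv_mul_cancel₀ (Nat.cast_ne_zero.2 k.factorial_ne_zero), map_one]
  rw [taylor_coeff, hderiv, ← mul_assoc, hfact, one_mul]

theorem mul_aeval_add_derivative_eq_sum (P : K[X]) (z t : A) :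
    t * aeval (z + t) (derivative P) = ∑ k ∈ Finset.range (P.natDegree + 1),
      algebraMap K A ((k : K) / (k.factorial : K)) * aeval z (derivative^[k] P) * t ^ k := by
  rcases Nat.eq_zero_or_pos P.natDegree with hdeg | hdeg
  · simp [hdeg, derivative_of_natDegree_zero hdeg]
  rw [aeval_add_eq_sum_iterate_derivative (derivative P) z t (natDegree_derivative_lt hdeg.ne'),
    Finset.sum_range_succ', Finset.mul_sum]
  simp only [Nat.cast_zero, zero_div, map_zero, zero_mul, add_zero]
  refine Finset.sum_congr rfl fun k _ => ?_
  have hk : ((k + 1 : ℕ) : K) / ((k + 1).factorial : K) = (k.factorial : K)⁻¹ := by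
    rw [Nat.factorial_succ, Nat.cast_mul, div_mul_cancel_left₀ (Nat.cast_ne_zero.2 k.succ_ne_zero)]
  rw [hk, Function.iterate_succ_apply]
  ring

theorem sum_sub_div_factorial_mul_iterate_derivative (P : K[X]) (a : K) (z t : A) :
    ∑ k ∈ Finset.range (P.natDegree + 1),
      algebraMap K A ((a - k) / (k.factorial : K)) * aeval z (derivative^[k] P) * t ^ k =
      algebraMap K A a * aeval (z + t) P - t * aeval (z + t) (derivative P) := by
  rw [mul_aeval_add_derivative_eq_sum,
    aeval_add_eq_sum_iterate_derivative P z t (Nat.lt_succ_self _), Finset.mul_sum,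
    ← Finset.sum_sub_distrib]
  refine Finset.sum_congr rfl fun k _ => ?_
  rw [sub_div, div_eq_mul_inv a, map_sub, map_mul]
  ring

end Taylor

section ScaledSymbol

variable {A : Type*} [CommRing A] [Algebra ℂ A] {P : ℂ[X]} {α : ℝ}

theorem aevalAeval_scaledSymbol_eq_sum (P : ℂ[X]) (α : ℝ) (z w : A) :
    aevalAeval (R := ℂ) z w (scaledSymbol P α) = ∑ k ∈ Finset.range (P.natDegree + 1),
      algebraMap ℂ A (((α : ℂ) - k) / (k.factorial : ℂ)) * aeval z (derivative^[k] P)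
        * w ^ (P.natDegree - k) := by
  rw [scaledSymbol, map_sum]
  refine Finset.sum_congr rfl fun k _ => ?_
  rw [map_mul, map_pow, aevalAeval_C, aevalAeval_Y, map_mul, aeval_C]

theorem aevalAeval_scaledSymbol (hd : P.natDegree ≠ 0) (α : ℝ) {z w v : A} (hwv : w * v = 1) :
    aevalAeval (R := ℂ) z w (scaledSymbol P α) = w ^ (P.natDegree - 1) *
      (algebraMap ℂ A α * w * aeval (z + v) P - aeval (z + v) (derivative P)) := by
  have hsum : aevalAeval (R := ℂ) z w (scaledSymbol P α) = w ^ P.natDegree *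
      (algebraMap ℂ A α * aeval (z + v) P - v * aeval (z + v) (derivative P)) := by
    rw [← sum_sub_div_factorial_mul_iterate_derivative, aevalAeval_scaledSymbol_eq_sum,
      Finset.mul_sum]
    refine Finset.sum_congr rfl fun k hk => ?_
    have hkd : k ≤ P.natDegree := Nat.lt_succ_iff.1 (Finset.mem_range.1 hk)
    have hpow : w ^ P.natDegree * v ^ k = w ^ (P.natDegree - k) := by
      rw [← Nat.sub_add_cancel hkd, pow_add, mul_assoc, ← mul_pow, hwv, one_pow, mul_one,
        Nat.add_sub_cancel]
    rw [← hpow]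
    ring
  rw [hsum, ← mul_pow_sub_one hd w]
  linear_combination -(w ^ (P.natDegree - 1)) * aeval (z + v) (derivative P) * hwv

theorem aevalAeval_scaledSymbol_eq_zero_iff (hd : P.natDegree ≠ 0) {z w v : A}
    (hwv : w * v = 1) : aevalAeval (R := ℂ) z w (scaledSymbol P α) = 0 ↔
      algebraMap ℂ A α * w * aeval (z + v) P = aeval (z + v) (derivative P) := by
  rw [aevalAeval_scaledSymbol hd α hwv,
    ((IsUnit.of_mul_eq_one _ hwv).pow _).mul_right_eq_zero, sub_eq_zero]

theorem evalEval_scaledSymbol (hd : P.natDegree ≠ 0) (α : ℝ) (z : ℂ) {w : ℂ} (hw : w ≠ 0) :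
    (scaledSymbol P α).evalEval z w = w ^ (P.natDegree - 1) *
      (α * w * P.eval (z + w⁻¹) - (derivative P).eval (z + w⁻¹)) := by
  simpa only [coe_aevalAeval_eq_evalEval, coe_aeval_eq_eval, Algebra.algebraMap_self_apply] using
    aevalAeval_scaledSymbol hd α (z := z) (mul_inv_cancel₀ hw)

theorem coeff_scaledSymbol (P : ℂ[X]) (α : ℝ) {k : ℕ} (hk : k ≤ P.natDegree) :
    (scaledSymbol P α).coeff (P.natDegree - k) =
      C (((α : ℂ) - k) / (k.factorial : ℂ)) * derivative^[k] P := by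
  rw [scaledSymbol, finsetSum_coeff, Finset.sum_eq_single k]
  · rw [coeff_C_mul, coeff_X_pow, if_pos rfl, mul_one]
  · intro j hj hjk
    have := Nat.lt_succ_iff.1 (Finset.mem_range.1 hj)
    rw [coeff_C_mul, coeff_X_pow, if_neg (by lia), mul_zero]
  · exact fun h => absurd (Finset.mem_range.2 (Nat.lt_succ_iff.2 hk)) h

theorem natDegree_scaledSymbol (hP : P ≠ 0) (hα : α ≠ 0) :
    (scaledSymbol P α).natDegree = P.natDegree := by
  refine natDegree_eq_of_le_of_coeff_ne_zero ?_ ?_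
  · exact natDegree_sum_le_of_forall_le _ _ fun k _ =>
      (natDegree_C_mul_X_pow_le _ _).trans (Nat.sub_le _ _)
  · have hcoeff := coeff_scaledSymbol P α (Nat.zero_le P.natDegree)
    rw [Nat.sub_zero] at hcoeff
    simp [hcoeff, hP, hα]

theorem leadingCoeff_scaledSymbol (hP : P ≠ 0) (hα : α ≠ 0) :
    (scaledSymbol P α).leadingCoeff = C (α : ℂ) * P := by
  rw [leadingCoeff, natDegree_scaledSymbol hP hα]
  simpa using coeff_scaledSymbol P α (Nat.zero_le P.natDegree)

theorem coeff_zero_scaledSymbol (P : ℂ[X]) (α : ℝ) :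
    (scaledSymbol P α).coeff 0 = C (((α : ℂ) - P.natDegree) * P.leadingCoeff) := by
  have hcoeff := coeff_scaledSymbol P α le_rfl
  rw [Nat.sub_self, ← factorial_smul_hasseDeriv, LinearMap.smul_apply,
    hasseDeriv_natDegree_eq_C] at hcoeff
  rw [hcoeff, nsmul_eq_mul, ← C_eq_natCast, ← C_mul, ← C_mul, ← mul_assoc,
    div_mul_cancel₀ _ (Nat.cast_ne_zero.2 P.natDegree.factorial_ne_zero)]

theorem sub_natDegree_mul_leadingCoeff_ne_zero (hP : P ≠ 0) (hα : α ≠ P.natDegree) :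
    ((α : ℂ) - P.natDegree) * P.leadingCoeff ≠ 0 :=
  mul_ne_zero (sub_ne_zero.2 (by exact_mod_cast hα)) (leadingCoeff_ne_zero.2 hP)

theorem isUnit_of_aevalAeval_scaledSymbol_eq_zero (hP : P ≠ 0) (hα : α ≠ P.natDegree) {z w : A}
    (h : aevalAeval (R := ℂ) z w (scaledSymbol P α) = 0) : IsUnit w := by
  have hconst := (isUnit_iff_ne_zero.2 (sub_natDegree_mul_leadingCoeff_ne_zero hP hα)).map
    (algebraMap ℂ A)
  have hsplit := congrArg (aevalAeval (R := ℂ) z w) (X_mul_divX_add (scaledSymbol P α))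
  rw [h, map_add, map_mul, coeff_zero_scaledSymbol, aevalAeval_Y, aevalAeval_C, aeval_C,
    ← eq_neg_iff_add_eq_zero] at hsplit
  exact isUnit_of_mul_isUnit_left (hsplit ▸ hconst.neg)

/-! ### The coordinate ring -/

theorem exists_isUnit_aeval_of_aevalAeval_scaledSymbol_eq_zero (hd : P.natDegree ≠ 0)
    (hP : P.Separable) (hα : α ≠ 0) (hαd : α ≠ P.natDegree) {x y : A}
    (h : aevalAeval (R := ℂ) x y (scaledSymbol P α) = 0) :
    ∃ v, y * v = 1 ∧ IsUnit (aeval (x + v) (P * derivative P)) := by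
  have hy := isUnit_of_aevalAeval_scaledSymbol_eq_zero hP.ne_zero hαd h
  obtain ⟨v, hv⟩ := hy.exists_right_inv
  have hrel := (aevalAeval_scaledSymbol_eq_zero_iff hd hv).1 h
  have ha : IsUnit (algebraMap ℂ A α) :=
    (isUnit_iff_ne_zero.2 (Complex.ofReal_ne_zero.2 hα)).map _
  obtain ⟨r, s, hrs⟩ := hP
  have hbezout := congrArg (aeval (x + v)) hrs
  simp only [map_add, map_mul, map_one] at hbezout
  have hPu : IsUnit (aeval (x + v) P) :=
    IsUnit.of_mul_eq_one (aeval (x + v) r + aeval (x + v) s * (algebraMap ℂ A α * y)) <| by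
      linear_combination hbezout + aeval (x + v) s * hrel
  refine ⟨v, hv, ?_⟩
  rw [map_mul, ← hrel]
  exact hPu.mul ((ha.mul hy).mul hPu)

theorem exists_aevalAeval_scaledSymbol_eq_zero_of_isUnit_aeval (hd : P.natDegree ≠ 0) (hα : α ≠ 0)
    {u : A} (hu : IsUnit (aeval u (P * derivative P))) :
    ∃ x y v, y * v = 1 ∧ x + v = u ∧ aevalAeval (R := ℂ) x y (scaledSymbol P α) = 0 := by
  rw [map_mul, IsUnit.mul_iff] at hu
  obtain ⟨q, hq⟩ := hu.1.exists_right_inv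
  obtain ⟨q', hq'⟩ := hu.2.exists_right_inv
  have ha : algebraMap ℂ A (α : ℂ) * algebraMap ℂ A (α : ℂ)⁻¹ = 1 := by
    rw [← map_mul, mul_inv_cancel₀ (Complex.ofReal_ne_zero.2 hα), map_one]
  have hyv : algebraMap ℂ A (α : ℂ)⁻¹ * q * aeval u (derivative P) *
      (algebraMap ℂ A α * aeval u P * q') = 1 := by
    linear_combination (exp := 1) (aeval u P * q * (aeval u (derivative P) * q')) * ha +
      (aeval u (derivative P) * q') * hq + hq'
  refine ⟨u - _, _, _, hyv, sub_add_cancel _ _,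
    (aevalAeval_scaledSymbol_eq_zero_iff hd hyv).2 ?_⟩
  rw [sub_add_cancel]
  linear_combination (aeval u P * q * aeval u (derivative P)) * ha + aeval u (derivative P) * hq

theorem eq_and_eq_of_aevalAeval_scaledSymbol_eq_zero (hd : P.natDegree ≠ 0) (hα : α ≠ 0)
    {x y v x' y' v' : A} (hyv : y * v = 1) (hyv' : y' * v' = 1) (huu' : x + v = x' + v')
    (hu : IsUnit (aeval (x + v) (P * derivative P)))
    (h : aevalAeval (R := ℂ) x y (scaledSymbol P α) = 0)
    (h' : aevalAeval (R := ℂ) x' y' (scaledSymbol P α) = 0) : x = x' ∧ y = y' := by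
  rw [aevalAeval_scaledSymbol_eq_zero_iff hd hyv] at h
  rw [aevalAeval_scaledSymbol_eq_zero_iff hd hyv', ← huu', ← h] at h'
  have ha : IsUnit (algebraMap ℂ A α) :=
    (isUnit_iff_ne_zero.2 (Complex.ofReal_ne_zero.2 hα)).map _
  rw [map_mul] at hu
  obtain rfl : y' = y := ha.mul_left_cancel ((isUnit_of_mul_isUnit_left hu).mul_right_cancel h')
  obtain rfl : v' = v := (IsUnit.of_mul_eq_one _ hyv).mul_left_cancel (hyv'.trans hyv.symm)
  exact ⟨add_right_cancel huu', rfl⟩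

end ScaledSymbol

/-- The coordinate ring `ℂ[z, w] / (F)` of the affine plane curve `F = 0`. It is not reducible, so
that every instance on it is found through `CommRing`. -/
def CoordinateRing (F : ℂ[X][Y]) : Type := ℂ[X][Y] ⧸ Ideal.span {F}

namespace CoordinateRing

noncomputable instance (F : ℂ[X][Y]) : CommRing (CoordinateRing F) :=
  inferInstanceAs (CommRing (ℂ[X][Y] ⧸ Ideal.span {F}))

noncomputable instance (F : ℂ[X][Y]) : Algebra ℂ (CoordinateRing F) :=
  inferInstanceAs (Algebra ℂ (ℂ[X][Y] ⧸ Ideal.span {F}))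

/-- The quotient map from `ℂ[z, w]` to the coordinate ring. -/
noncomputable def mk (F : ℂ[X][Y]) : ℂ[X][Y] →ₐ[ℂ] CoordinateRing F :=
  Ideal.Quotient.mkₐ ℂ (Ideal.span {F})

variable {A : Type*} [CommRing A] [Algebra ℂ A] {F : ℂ[X][Y]}

/-- The class of the coordinate `z` in the coordinate ring. -/
noncomputable def z (F : ℂ[X][Y]) : CoordinateRing F := mk F (C X)

/-- The class of the coordinate `w` in the coordinate ring. -/
noncomputable def w (F : ℂ[X][Y]) : CoordinateRing F := mk F Y

theorem aevalAeval_z_w (F : ℂ[X][Y]) : aevalAeval (R := ℂ) (z F) (w F) F = 0 := by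
  have hmk : aevalAeval (R := ℂ) (z F) (w F) = mk F := by
    ext <;> simp [z, w]
  rw [hmk]
  exact Ideal.Quotient.eq_zero_iff_mem.2 (Ideal.mem_span_singleton_self F)

/-- The algebra homomorphism out of the coordinate ring given by a point `(x, y)` of the curve. -/
noncomputable def lift (x y : A) (h : aevalAeval (R := ℂ) x y F = 0) : CoordinateRing F →ₐ[ℂ] A :=
  Ideal.Quotient.liftₐ _ (aevalAeval x y) fun G hG => by
    obtain ⟨H, rfl⟩ := Ideal.mem_span_singleton.1 hG
    rw [map_mul, h, zero_mul]

theorem lift_z {x y : A} (h : aevalAeval (R := ℂ) x y F = 0) : lift x y h (z F) = x :=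
  aevalAeval_X x y

theorem lift_w {x y : A} (h : aevalAeval (R := ℂ) x y F = 0) : lift x y h (w F) = y :=
  aevalAeval_Y x y

theorem algHom_ext {f g : CoordinateRing F →ₐ[ℂ] A} (hz : f (z F) = g (z F))
    (hw : f (w F) = g (w F)) : f = g :=
  Ideal.Quotient.algHom_ext _ (Polynomial.algHom_ext' (Polynomial.algHom_ext hz) hw)

theorem aevalAeval_map (f : CoordinateRing F →ₐ[ℂ] A) :
    aevalAeval (R := ℂ) (f (z F)) (f (w F)) F = 0 := by
  have hcomp : aevalAeval (R := ℂ) (f (z F)) (f (w F)) = f.comp (aevalAeval (z F) (w F)) := by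
    ext <;> simp
  rw [hcomp, AlgHom.comp_apply, aevalAeval_z_w, map_zero]

variable {P : ℂ[X]} {α : ℝ}

/-- Both rings represent the functor of solutions: a point `(x, y)` of the curve with values in an
algebra is the same as an element `u = x + 1 / y` at which `P` and `P'` are invertible. -/
theorem nonempty_algEquiv_of_isLocalization_away (hd : P.natDegree ≠ 0) (hP : P.Separable)
    (hα : α ≠ 0) (hαd : α ≠ P.natDegree) (L : Type*) [CommRing L] [Algebra ℂ L] [Algebra ℂ[X] L]
    [IsScalarTower ℂ ℂ[X] L] [IsLocalization.Away (P * derivative P) L] :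
    Nonempty (CoordinateRing (scaledSymbol P α) ≃ₐ[ℂ] L) := by
  have hX (f : ℂ[X]) : aeval (algebraMap ℂ[X] L X) f = algebraMap ℂ[X] L f := by
    rw [aeval_algebraMap_apply, aeval_X_left_apply]
  obtain ⟨x, y, v, hyv, hxv, hxy⟩ := exists_aevalAeval_scaledSymbol_eq_zero_of_isUnit_aeval hd hα
    (hX (P * derivative P) ▸ IsLocalization.Away.algebraMap_isUnit (P * derivative P))
  obtain ⟨v', hyv', hu⟩ := exists_isUnit_aeval_of_aevalAeval_scaledSymbol_eq_zero hd hP hα hαd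
    (aevalAeval_z_w (scaledSymbol P α))
  let f : CoordinateRing (scaledSymbol P α) →ₐ[ℂ] L := lift x y hxy
  let g : L →ₐ[ℂ] CoordinateRing (scaledSymbol P α) :=
    IsLocalization.Away.liftAlgHom (P * derivative P) hu
  have hfz : f (z _) = x := lift_z hxy
  have hfw : f (w _) = y := lift_w hxy
  have hfv : f v' = v := (IsUnit.of_mul_eq_one _ hyv).mul_left_cancel <| by
    rw [hyv, ← hfw, ← map_mul, hyv', map_one]
  have hgX : g (algebraMap ℂ[X] L X) = z _ + v' :=
    (IsLocalization.Away.lift_eq _ hu X).trans (aeval_X _)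
  have hgyv : g y * g v = 1 := by rw [← map_mul, hyv, map_one]
  have hgxv : z _ + v' = g x + g v := by rw [← map_add, hxv, hgX]
  have hgxy : aevalAeval (R := ℂ) (g x) (g y) (scaledSymbol P α) = 0 := by
    rw [← hfz, ← hfw]
    exact aevalAeval_map (g.comp f)
  obtain ⟨hgz, hgw⟩ := eq_and_eq_of_aevalAeval_scaledSymbol_eq_zero hd hα hyv' hgyv hgxv hu
    (aevalAeval_z_w (scaledSymbol P α)) hgxy
  refine ⟨AlgEquiv.ofAlgHom f g ?_ ?_⟩
  · refine IsLocalization.algHom_ext (Submonoid.powers (P * derivative P))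
      (Polynomial.algHom_ext ?_)
    change f (g (algebraMap ℂ[X] L X)) = algebraMap ℂ[X] L X
    rw [hgX, map_add, hfz, hfv, hxv]
  · exact algHom_ext ((congrArg g hfz).trans hgz.symm) ((congrArg g hfw).trans hgw.symm)

end CoordinateRing

section Rationality

variable {P : ℂ[X]} {α : ℝ}

theorem scaledSymbol_ne_zero (hP : P ≠ 0) (hα : α ≠ P.natDegree) : scaledSymbol P α ≠ 0 := by
  intro h
  have hcoeff := coeff_zero_scaledSymbol P α
  rw [h, coeff_zero, eq_comm, C_eq_zero] at hcoeff
  exact sub_natDegree_mul_leadingCoeff_ne_zero hP hα hcoeff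

theorem mul_derivative_ne_zero (hd : P.natDegree ≠ 0) : P * derivative P ≠ 0 :=
  mul_ne_zero (ne_zero_of_natDegree_gt (Nat.pos_of_ne_zero hd)) (mt derivative_eq_zero.1 hd)

theorem irreducible_scaledSymbol (hd : P.natDegree ≠ 0) (hP : P.Separable) (hα : α ≠ 0)
    (hαd : α ≠ P.natDegree) : Irreducible (scaledSymbol P α) := by
  obtain ⟨e⟩ := CoordinateRing.nonempty_algEquiv_of_isLocalization_away hd hP hα hαd
    (Localization.Away (P * derivative P))
  have := IsLocalization.isDomain_localization
    (powers_le_nonZeroDivisors_of_noZeroDivisors (mul_derivative_ne_zero hd))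
  have hdomain : IsDomain (ℂ[X][Y] ⧸ Ideal.span {scaledSymbol P α}) :=
    e.toMulEquiv.isDomain _
  rw [Ideal.Quotient.isDomain_iff_prime,
    Ideal.span_singleton_prime (scaledSymbol_ne_zero hP.ne_zero hαd)] at hdomain
  exact hdomain.irreducible

theorem isRationalCurve_scaledSymbol (hd : P.natDegree ≠ 0) (hP : P.Separable) (hα : α ≠ 0)
    (hαd : α ≠ P.natDegree) : IsRationalCurve (scaledSymbol P α) := by
  refine ⟨irreducible_scaledSymbol hd hP hα hαd, ?_⟩
  have hle := powers_le_nonZeroDivisors_of_noZeroDivisors (mul_derivative_ne_zero hd)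
  obtain ⟨e⟩ := CoordinateRing.nonempty_algEquiv_of_isLocalization_away hd hP hα hαd
    (Localization.subalgebra.ofField (RatFunc ℂ) (Submonoid.powers (P * derivative P)) hle)
  exact ⟨IsFractionRing.algEquivOfAlgEquiv (R := ℂ)
    (A := ℂ[X][Y] ⧸ Ideal.span {scaledSymbol P α}) (K := FractionRing _) e⟩

end Rationality

/-! ### The slopes at `(∞, 0)` -/

theorem reflect_add_of_natDegree_le {R : Type*} [Semiring R] {f : R[X]} {m : ℕ}
    (hf : f.natDegree ≤ m) (n : ℕ) : reflect (m + n) f = reflect m f * X ^ n := by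
  simpa using reflect_mul f 1 hf (natDegree_one.trans_le n.zero_le)

theorem reflect_sum {ι R : Type*} [Semiring R] (N : ℕ) (s : Finset ι) (f : ι → R[X]) :
    reflect N (∑ i ∈ s, f i) = ∑ i ∈ s, reflect N (f i) :=
  map_sum (⟨⟨reflect N, reflect_zero⟩, fun f g => reflect_add f g N⟩ : R[X] →+ R[X]) f s

theorem coeff_zero_reflect_iterate_derivative {R : Type*} [Semiring R] (f : R[X]) {k : ℕ}
    (hk : k ≤ f.natDegree) : (reflect (f.natDegree - k) (derivative^[k] f)).coeff 0 =
      f.natDegree.descFactorial k * f.leadingCoeff := by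
  rw [coeff_reflect, revAt_le (Nat.zero_le _), Nat.sub_zero, coeff_iterate_derivative,
    Nat.sub_add_cancel hk, leadingCoeff, nsmul_eq_mul]

theorem roots_X_add_one_pow_mul_C_mul_X_add_one_sub_C {K : Type*} [Field K] {a : K} (ha : a ≠ 0)
    (b : K) (n : ℕ) : ((X + 1) ^ n * (C a * (X + 1) - C b)).roots =
      (b / a - 1) ::ₘ Multiset.replicate n (-1) := by
  have hlin : C a * (X + 1) - C b = C a * (X - C (b / a - 1)) := by
    rw [C_sub, C_1, mul_sub, mul_sub, ← C_mul, mul_div_cancel₀ b ha]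
    ring
  have hlin_ne : C a * (X - C (b / a - 1)) ≠ 0 := mul_ne_zero (C_ne_zero.2 ha) (X_sub_C_ne_zero _)
  have hone : (X + 1 : K[X]) = X - C (-1) := by rw [C_neg, C_1, sub_neg_eq_add]
  rw [hlin, hone, roots_mul (mul_ne_zero (pow_ne_zero _ (X_sub_C_ne_zero _)) hlin_ne), roots_pow,
    roots_C_mul _ ha, roots_X_sub_C, roots_X_sub_C, Multiset.nsmul_singleton, add_comm,
    Multiset.singleton_add]

section Slopes

variable {P : ℂ[X]} {α : ℝ}

theorem sum_descFactorial_mul_pow (α : ℝ) (d : ℕ) (s : ℂ) :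
    ∑ k ∈ Finset.range (d + 1), ((α : ℂ) - k) / k.factorial * d.descFactorial k * s ^ (d - k) =
      α * (s + 1) ^ d - d * (s + 1) ^ (d - 1) := by
  have htaylor := sum_sub_div_factorial_mul_iterate_derivative (X ^ d : ℂ[X]) α s 1
  simpa [iterate_derivative_X_pow_eq_natCast_mul, derivative_X_pow, mul_assoc] using htaylor

theorem swap_scaledSymbol (P : ℂ[X]) (α : ℝ) : Bivariate.swap (scaledSymbol P α) =
    ∑ k ∈ Finset.range (P.natDegree + 1), C (C (((α : ℂ) - k) / (k.factorial : ℂ)) *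
      X ^ (P.natDegree - k)) * (derivative^[k] P).map C := by
  rw [scaledSymbol, map_sum]
  refine Finset.sum_congr rfl fun k _ => ?_
  rw [map_mul, map_pow, Bivariate.swap_C, Bivariate.swap_Y, Polynomial.map_mul, map_C, C_mul, C_pow]
  ring

theorem natDegree_swap_scaledSymbol (hP : P ≠ 0) (hα : α ≠ 0) :
    (Bivariate.swap (scaledSymbol P α)).natDegree = P.natDegree := by
  rw [swap_scaledSymbol]
  refine natDegree_eq_of_le_of_coeff_ne_zero ?_ ?_
  · exact natDegree_sum_le_of_forall_le _ _ fun k _ => (natDegree_C_mul_le _ _).trans <|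
      natDegree_map_le.trans <| (natDegree_iterate_derivative P k).trans (Nat.sub_le _ _)
  · rw [finsetSum_coeff, Finset.sum_eq_single_of_mem 0 (by simp)]
    · rw [coeff_C_mul, coeff_map]
      simp [hP, hα]
    · intro k _ hk
      rw [coeff_C_mul, coeff_map, coeff_iterate_derivative,
        coeff_eq_zero_of_natDegree_lt (by lia), smul_zero, C_0, mul_zero]

theorem localEquation_scaledSymbol_infty_coe (hP : P ≠ 0) (hα : α ≠ 0) (w : ℂ) :
    localEquation (scaledSymbol P α) (OnePoint.infty, (w : OnePoint ℂ)) =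
      ∑ k ∈ Finset.range (P.natDegree + 1), C (C (((α : ℂ) - k) / (k.factorial : ℂ)) *
        (reflect (P.natDegree - k) (derivative^[k] P) * X ^ k)) * X ^ (P.natDegree - k) := by
  have hlocal : localEquation (scaledSymbol P α) (OnePoint.infty, (w : OnePoint ℂ)) =
      Bivariate.swap (Bivariate.swap (scaledSymbol P α)).reverse := by
    simp [localEquation]
  rw [hlocal, reverse, natDegree_swap_scaledSymbol hP hα, swap_scaledSymbol,
    reflect_sum, map_sum]
  refine Finset.sum_congr rfl fun k hk => ?_
  have hkd : k ≤ P.natDegree := Nat.lt_succ_iff.1 (Finset.mem_range.1 hk)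
  have hreflect : reflect P.natDegree (derivative^[k] P) =
      reflect (P.natDegree - k) (derivative^[k] P) * X ^ k := by
    rw [← reflect_add_of_natDegree_le (natDegree_iterate_derivative P k), Nat.sub_add_cancel hkd]
  rw [reflect_C_mul, reflect_map, hreflect, map_mul, Bivariate.swap_C, Bivariate.swap_map_C]
  simp only [Polynomial.map_mul, map_C, Polynomial.map_pow, map_X, map_mul, map_pow]
  ring

theorem hasSlopePolynomial_scaledSymbol (hd : P.natDegree ≠ 0) (hα : α ≠ 0) :
    HasSlopePolynomial
      (localEquation (scaledSymbol P α) (OnePoint.infty, ((0 : ℂ) : OnePoint ℂ))) P.natDegree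
      (C P.leadingCoeff * ((X + 1) ^ (P.natDegree - 1) *
        (C (α : ℂ) * (X + 1) - C (P.natDegree : ℂ)))) := by
  have hP : P ≠ 0 := ne_zero_of_natDegree_gt (Nat.pos_of_ne_zero hd)
  have hα' : (α : ℂ) ≠ 0 := Complex.ofReal_ne_zero.2 hα
  refine ⟨mul_ne_zero (C_ne_zero.2 (leadingCoeff_ne_zero.2 hP))
      (ne_zero_of_mem_roots (a := (P.natDegree : ℂ) / α - 1) ?_),
    ∑ k ∈ Finset.range (P.natDegree + 1), C (C (((α : ℂ) - k) / (k.factorial : ℂ)) *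
      divX (reflect (P.natDegree - k) (derivative^[k] P))) * X ^ (P.natDegree - k),
    fun y s => ?_⟩
  · rw [roots_X_add_one_pow_mul_C_mul_X_add_one_sub_C hα']
    exact Multiset.mem_cons_self _ _
  have heval : eval s (C P.leadingCoeff * ((X + 1) ^ (P.natDegree - 1) *
      (C (α : ℂ) * (X + 1) - C (P.natDegree : ℂ)))) = P.leadingCoeff *
        (α * (s + 1) ^ P.natDegree - P.natDegree * (s + 1) ^ (P.natDegree - 1)) := by
    rw [← pow_sub_one_mul hd]
    simp only [eval_mul, eval_C, eval_pow, eval_add, eval_X, eval_one, eval_sub]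
    ring
  rw [localEquation_scaledSymbol_infty_coe hP hα, heval, ← sum_descFactorial_mul_pow,
    evalEval_finsetSum, evalEval_finsetSum, Finset.mul_sum, Finset.mul_sum,
    ← Finset.sum_add_distrib, Finset.mul_sum]
  refine Finset.sum_congr rfl fun k hk => ?_
  have hkd : k ≤ P.natDegree := Nat.lt_succ_iff.1 (Finset.mem_range.1 hk)
  have hsplit := congrArg (eval y) (X_mul_divX_add
    (reflect (P.natDegree - k) (derivative^[k] P)))
  rw [coeff_zero_reflect_iterate_derivative P hkd, eval_add, eval_mul, eval_X, eval_C] at hsplit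
  simp only [evalEval_mul, evalEval_C, evalEval_pow, evalEval_X, eval_mul, eval_C, eval_pow, eval_X,
    mul_pow]
  rw [← hsplit, ← pow_sub_mul_pow y hkd]
  ring

end Slopes

/-! ### Singular points -/

section SingularPoints

theorem differentiable_evalEval (G : ℂ[X][Y]) :
    Differentiable ℂ fun x : ℂ × ℂ => G.evalEval x.1 x.2 := by
  induction G using Polynomial.induction_on' with
  | add p q hp hq =>
    simp only [evalEval_add]
    exact hp.add hq
  | monomial n c =>
    simp only [← C_mul_X_pow_eq_monomial, evalEval_mul, evalEval_C, evalEval_pow, evalEval_X]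
    exact (c.differentiable.comp differentiable_fst).mul (differentiable_snd.pow n)

theorem hasDerivAt_evalEval (G : ℂ[X][Y]) {a b : ℂ → ℂ} {a' b' t : ℂ} (ha : HasDerivAt a a' t)
    (hb : HasDerivAt b b' t) : HasDerivAt (fun s => G.evalEval (a s) (b s))
      (fderiv ℂ (fun x : ℂ × ℂ => G.evalEval x.1 x.2) (a t, b t) (a', b')) t :=
    HasFDerivAt.comp_hasDerivAt (f := fun s => (a s, b s)) t
    (differentiable_evalEval G (a t, b t)).hasFDerivAt (ha.prodMk hb)

theorem HasSlopePolynomial.fderiv_eq_zero {G : ℂ[X][Y]} {m : ℕ} {q : ℂ[X]}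
    (h : HasSlopePolynomial G m q) (hm : 2 ≤ m) :
    fderiv ℂ (fun x : ℂ × ℂ => G.evalEval x.1 x.2) (0, 0) = 0 := by
  obtain ⟨-, R, hR⟩ := h
  have hline (s : ℂ) : fderiv ℂ (fun x : ℂ × ℂ => G.evalEval x.1 x.2) (0, 0) (1, s) = 0 := by
    have hG := hasDerivAt_evalEval G (hasDerivAt_id 0) ((hasDerivAt_id 0).const_mul s)
    have hR' := hasDerivAt_evalEval R (hasDerivAt_id 0) (hasDerivAt_const 0 s)
    have hpow := (hasDerivAt_pow m (0 : ℂ)).mul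
      (((hasDerivAt_id 0).mul hR').const_add (q.eval s))
    rw [zero_pow (by lia), zero_pow (by lia), mul_zero, zero_mul, zero_mul, add_zero] at hpow
    have hunique := hG.unique (hpow.congr_of_eventuallyEq (.of_forall fun t => hR t s))
    simpa only [id_eq, mul_zero, mul_one] using hunique
  ext
  · simpa using hline 0
  · have hsub := map_sub (fderiv ℂ (fun x : ℂ × ℂ => G.evalEval x.1 x.2) (0, 0)) (1, 1) (1, 0)
    rw [hline, hline, Prod.mk_sub_mk, sub_self, sub_zero, sub_self] at hsub
    simpa using hsub

variable {P : ℂ[X]} {α : ℝ}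

theorem hasDerivAt_evalEval_scaledSymbol_sub_inv (hd : P.natDegree ≠ 0) {u w : ℂ} (hw : w ≠ 0)
    (h : α * w * P.eval u = (derivative P).eval u) :
    HasDerivAt (fun t => (scaledSymbol P α).evalEval (u - t⁻¹) t)
      (w ^ (P.natDegree - 1) * (α * P.eval u)) w := by
  have hlin : HasDerivAt (fun t : ℂ => α * t * P.eval u - (derivative P).eval u)
      (α * P.eval u) w := by
    simpa using (((hasDerivAt_id w).const_mul (α : ℂ)).mul_const (P.eval u)).sub_const
      ((derivative P).eval u)
  have hprod := (hasDerivAt_pow (P.natDegree - 1) w).mul hlin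
  rw [h, sub_self, mul_zero, zero_add] at hprod
  refine hprod.congr_of_eventuallyEq ?_
  filter_upwards [isOpen_ne.mem_nhds hw] with t ht
  rw [evalEval_scaledSymbol hd α _ ht, sub_add_cancel]
  rfl

theorem fderiv_evalEval_scaledSymbol_ne_zero (hd : P.natDegree ≠ 0) (hP : P.Separable)
    (hα : α ≠ 0) (hαd : α ≠ P.natDegree) {z w : ℂ} (h : (scaledSymbol P α).evalEval z w = 0) :
    fderiv ℂ (fun x : ℂ × ℂ => (scaledSymbol P α).evalEval x.1 x.2) (z, w) ≠ 0 := by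
  rw [← coe_aevalAeval_eq_evalEval] at h
  obtain ⟨v, hwv, hu⟩ := exists_isUnit_aeval_of_aevalAeval_scaledSymbol_eq_zero hd hP hα hαd h
  have hrel := (aevalAeval_scaledSymbol_eq_zero_iff hd hwv).1 h
  have hw : w ≠ 0 := left_ne_zero_of_mul_eq_one hwv
  obtain rfl : v = w⁻¹ := eq_inv_of_mul_eq_one_right hwv
  have hPu : P.eval (z + w⁻¹) ≠ 0 := by
    rw [map_mul] at hu
    exact left_ne_zero_of_mul hu.ne_zero
  intro h0
  have hcurve := hasDerivAt_evalEval (scaledSymbol P α) ((hasDerivAt_inv hw).const_sub (z + w⁻¹))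
    (hasDerivAt_id w)
  simp only [id_eq, add_sub_cancel_right, h0, zero_apply] at hcurve
  exact mul_ne_zero (pow_ne_zero _ hw) (mul_ne_zero (Complex.ofReal_ne_zero.2 hα) hPu)
    ((hasDerivAt_evalEval_scaledSymbol_sub_inv hd hw hrel).unique hcurve)

theorem fderiv_evalEval_reverse_scaledSymbol_ne_zero (hα : α ≠ 0) {z : ℂ}
    (h : (derivative P).eval z ≠ 0) :
    fderiv ℂ (fun x : ℂ × ℂ => (scaledSymbol P α).reverse.evalEval x.1 x.2) (z, 0) ≠ 0 := by
  intro h0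
  have hP : P ≠ 0 := by
    rintro rfl
    simp at h
  have hcurve := hasDerivAt_evalEval (scaledSymbol P α).reverse (hasDerivAt_id z)
    (hasDerivAt_const z 0)
  have heval (t : ℂ) : (scaledSymbol P α).reverse.evalEval t 0 = α * P.eval t := by
    rw [evalEval, C_0, ← coeff_zero_eq_eval_zero, coeff_zero_reverse,
      leadingCoeff_scaledSymbol hP hα, eval_mul, eval_C]
  simp only [id_eq, heval, h0, zero_apply] at hcurve
  exact mul_ne_zero (Complex.ofReal_ne_zero.2 hα) h
    (((P.hasDerivAt z).const_mul _).unique hcurve)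

end SingularPoints

/-! ### Holomorphic maps of the Riemann sphere -/

namespace RiemannSphere

theorem finiteChart_coe (z : ℂ) : finiteChart (z : OnePoint ℂ) = z :=
  (OnePoint.isOpenEmbedding_coe.toOpenPartialHomeomorph ((↑) : ℂ → OnePoint ℂ)).left_inv
    (Set.mem_univ z)

theorem finiteChart_symm_apply (z : ℂ) : finiteChart.symm z = (z : OnePoint ℂ) := rfl

theorem coe_mem_finiteChart_source (z : ℂ) : (z : OnePoint ℂ) ∈ finiteChart.source := by
  simp [finiteChart]

theorem inftyChart_apply (x : OnePoint ℂ) : inftyChart x = finiteChart (inv x) := rfl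

theorem inftyChart_symm_apply (z : ℂ) : inftyChart.symm z = inv (z : OnePoint ℂ) := rfl

theorem inftyChart_inv_coe (z : ℂ) : inftyChart (inv (z : OnePoint ℂ)) = z := by
  rw [inftyChart_apply, inv_involutive, finiteChart_coe]

theorem mem_inftyChart_source {x : OnePoint ℂ} :
    x ∈ inftyChart.source ↔ inv x ∈ finiteChart.source := by
  simp only [inftyChart, OpenPartialHomeomorph.trans_source,
    Homeomorph.toOpenPartialHomeomorph_source, Set.univ_inter]
  rfl

theorem inv_coe_mem_inftyChart_source (z : ℂ) : inv (z : OnePoint ℂ) ∈ inftyChart.source := by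
  rw [mem_inftyChart_source, inv_involutive]
  exact coe_mem_finiteChart_source z

theorem inv_coe_zero : inv ((0 : ℂ) : OnePoint ℂ) = OnePoint.infty := by
  simp [inv_coe]

theorem inv_coe_of_ne_zero {z : ℂ} (hz : z ≠ 0) :
    inv (z : OnePoint ℂ) = ((z⁻¹ : ℂ) : OnePoint ℂ) := by
  simp [inv_coe, hz]

theorem finiteChart_mem_atlas : finiteChart ∈ atlas ℂ (OnePoint ℂ) := Set.mem_insert _ _

theorem inftyChart_mem_atlas : inftyChart ∈ atlas ℂ (OnePoint ℂ) :=
  Set.mem_insert_of_mem _ rfl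

theorem chartAt_coe (z : ℂ) : chartAt ℂ (z : OnePoint ℂ) = finiteChart :=
  if_neg (OnePoint.coe_ne_infty z)

theorem chartAt_infty : chartAt ℂ (OnePoint.infty : OnePoint ℂ) = inftyChart :=
  if_pos rfl

theorem chartAt_coe_apply_self (z : ℂ) : chartAt ℂ (z : OnePoint ℂ) (z : OnePoint ℂ) = z := by
  rw [chartAt_coe, finiteChart_coe]

theorem chartAt_infty_apply_self :
    chartAt ℂ (OnePoint.infty : OnePoint ℂ) (OnePoint.infty : OnePoint ℂ) = 0 := by
  rw [chartAt_infty, inftyChart_apply, inv_infty, finiteChart_coe]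

theorem nhds_infty_eq_map : 𝓝 (OnePoint.infty : OnePoint ℂ) =
    map (fun t : ℂ => inv (t : OnePoint ℂ)) (𝓝 0) := by
  have h := invHomeomorph.map_nhds_eq ((0 : ℂ) : OnePoint ℂ)
  rw [OnePoint.nhds_coe_eq, map_map] at h
  rw [← inv_coe_zero]
  exact h.symm

theorem coord_coe (z : ℂ) : coord (z : OnePoint ℂ) = z := rfl

theorem coord_infty : coord OnePoint.infty = 0 := rfl

theorem contDiffAt_finiteChart_inv {z : ℂ} (hz : inv (z : OnePoint ℂ) ∈ finiteChart.source) :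
    ContDiffAt ℂ ω (fun t : ℂ => finiteChart (inv (t : OnePoint ℂ))) z := by
  have hz0 : z ≠ 0 := by
    rintro rfl
    rw [inv_coe_zero] at hz
    simp [finiteChart] at hz
  refine (contDiffAt_inv ℂ hz0).congr_of_eventuallyEq ?_
  filter_upwards [isOpen_ne.mem_nhds hz0] with t ht
  rw [inv_coe_of_ne_zero ht, finiteChart_coe]

instance : IsManifold 𝓘(ℂ) ω (OnePoint ℂ) := by
  refine isManifold_of_contDiffOn _ _ _ fun e e' he he' => ?_
  rintro z ⟨hz, -⟩
  refine ContDiffAt.contDiffWithinAt ?_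
  have hz' : z ∈ (e.symm ≫ₕ e').source := hz
  rw [OpenPartialHomeomorph.trans_source] at hz'
  change ContDiffAt ℂ ω (fun t : ℂ => e' (e.symm t)) z
  have he'z : e.symm z ∈ e'.source := hz'.2
  rcases he with rfl | rfl <;> rcases he' with rfl | rfl
  · simp only [finiteChart_symm_apply, finiteChart_coe]
    exact contDiffAt_id
  · simp only [finiteChart_symm_apply, inftyChart_apply]
    exact contDiffAt_finiteChart_inv (mem_inftyChart_source.1 he'z)
  · simp only [inftyChart_symm_apply]
    exact contDiffAt_finiteChart_inv he'z
  · simp only [inftyChart_symm_apply, inftyChart_inv_coe]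
    exact contDiffAt_id

theorem mdifferentiable_coe : MDifferentiable 𝓘(ℂ) 𝓘(ℂ) ((↑) : ℂ → OnePoint ℂ) := fun z =>
  mdifferentiableAt_atlas_symm (I := 𝓘(ℂ)) finiteChart_mem_atlas
    (finiteChart_coe z ▸ finiteChart.map_source (coe_mem_finiteChart_source z))

theorem mdifferentiable_inv_coe :
    MDifferentiable 𝓘(ℂ) 𝓘(ℂ) fun z : ℂ => inv (z : OnePoint ℂ) := fun z =>
  mdifferentiableAt_atlas_symm (I := 𝓘(ℂ)) inftyChart_mem_atlas
    (inftyChart_inv_coe z ▸ inftyChart.map_source (inv_coe_mem_inftyChart_source z))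

theorem mdifferentiableAt_coe_of_comp {f : OnePoint ℂ → OnePoint ℂ} {z : ℂ}
    (h : MDifferentiableAt 𝓘(ℂ) 𝓘(ℂ) (fun t : ℂ => f (t : OnePoint ℂ)) z) :
    MDifferentiableAt 𝓘(ℂ) 𝓘(ℂ) f (z : OnePoint ℂ) := by
  have h_chart := mdifferentiableAt_atlas (I := 𝓘(ℂ)) finiteChart_mem_atlas
    (coe_mem_finiteChart_source z)
  rw [← finiteChart_coe z] at h
  refine (h.comp (z : OnePoint ℂ) h_chart).congr_of_eventuallyEq ?_
  rw [OnePoint.nhds_coe_eq, EventuallyEq, eventually_map]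
  exact Eventually.of_forall fun t => by simp [finiteChart_coe]

theorem mdifferentiableAt_infty_of_comp {f : OnePoint ℂ → OnePoint ℂ}
    (h : MDifferentiableAt 𝓘(ℂ) 𝓘(ℂ) (fun t : ℂ => f (inv (t : OnePoint ℂ))) 0) :
    MDifferentiableAt 𝓘(ℂ) 𝓘(ℂ) f OnePoint.infty := by
  have h_chart := mdifferentiableAt_atlas (I := 𝓘(ℂ)) inftyChart_mem_atlas
    (inv_coe_mem_inftyChart_source 0)
  rw [← inftyChart_inv_coe 0] at h
  have h_comp := h.comp (inv ((0 : ℂ) : OnePoint ℂ)) h_chart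
  rw [inv_coe_zero] at h_comp
  refine h_comp.congr_of_eventuallyEq ?_
  rw [nhds_infty_eq_map, EventuallyEq, eventually_map]
  exact Eventually.of_forall fun t => by simp [inftyChart_inv_coe]

open Classical in
/-- The point of the Riemann sphere with homogeneous coordinates `[a : b]`; the excluded pair
`[0 : 0]` is sent to `∞`. -/
noncomputable def ratio (a b : ℂ) : OnePoint ℂ :=
  if b = 0 then OnePoint.infty else ((a / b : ℂ) : OnePoint ℂ)

theorem ratio_zero_right (a : ℂ) : ratio a 0 = OnePoint.infty := if_pos rfl

theorem ratio_of_ne_zero (a : ℂ) {b : ℂ} (hb : b ≠ 0) :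
    ratio a b = ((a / b : ℂ) : OnePoint ℂ) := if_neg hb

theorem ratio_eq_infty {a b : ℂ} : ratio a b = OnePoint.infty ↔ b = 0 := by
  by_cases h : b = 0 <;> simp [ratio, h]

theorem coord_ratio (a b : ℂ) : coord (ratio a b) = a / b := by
  by_cases h : b = 0
  · rw [h, ratio_zero_right, coord_infty, div_zero]
  · rw [ratio_of_ne_zero _ h, coord_coe]

theorem ratio_eq_inv {a : ℂ} (ha : a ≠ 0) (b : ℂ) :
    ratio a b = inv ((b / a : ℂ) : OnePoint ℂ) := by
  by_cases h : b = 0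
  · rw [h, ratio_zero_right, zero_div, inv_coe_zero]
  · rw [ratio_of_ne_zero _ h, inv_coe_of_ne_zero (div_ne_zero h ha), inv_div]

theorem ratio_mul_left {c : ℂ} (hc : c ≠ 0) (a b : ℂ) : ratio (c * a) (c * b) = ratio a b := by
  by_cases h : b = 0
  · rw [h, mul_zero, ratio_zero_right, ratio_zero_right]
  · rw [ratio_of_ne_zero _ h, ratio_of_ne_zero _ (mul_ne_zero hc h), mul_div_mul_left _ _ hc]

theorem mdifferentiableAt_ratio {p q : ℂ → ℂ} {z : ℂ} (hp : DifferentiableAt ℂ p z)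
    (hq : DifferentiableAt ℂ q z) (h : p z ≠ 0 ∨ q z ≠ 0) :
    MDifferentiableAt 𝓘(ℂ) 𝓘(ℂ) (fun t => ratio (p t) (q t)) z := by
  rcases h with h | h
  · have h_div : MDifferentiableAt 𝓘(ℂ) 𝓘(ℂ) (fun t => q t / p t) z :=
      (hq.div hp h).mdifferentiableAt
    refine ((mdifferentiable_inv_coe _).comp z h_div).congr_of_eventuallyEq ?_
    filter_upwards [hp.continuousAt.eventually_ne h] with t ht
    exact ratio_eq_inv ht _
  · have h_div : MDifferentiableAt 𝓘(ℂ) 𝓘(ℂ) (fun t => p t / q t) z :=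
      (hp.div hq h).mdifferentiableAt
    refine ((mdifferentiable_coe _).comp z h_div).congr_of_eventuallyEq ?_
    filter_upwards [hq.continuousAt.eventually_ne h] with t ht
    exact ratio_of_ne_zero _ ht

end RiemannSphere

/-! ### Simple polar parts -/

/-- Near `x` the function `f` is `r / (t - x)` plus a holomorphic function. The residue `r` is
allowed to vanish, so that this notion is additive in `f`. -/
def HasSimplePolarPartAt (f : ℂ → ℂ) (x r : ℂ) : Prop :=
  ∃ g : ℂ → ℂ, AnalyticAt ℂ g x ∧ ∀ᶠ t in 𝓝[≠] x, f t = r / (t - x) + g t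

namespace HasSimplePolarPartAt

variable {f f₁ f₂ : ℂ → ℂ} {x r r₁ r₂ : ℂ}

theorem congr (h : HasSimplePolarPartAt f₁ x r) (hf : f₁ =ᶠ[𝓝[≠] x] f₂) :
    HasSimplePolarPartAt f₂ x r := by
  obtain ⟨g, hg, hfg⟩ := h
  exact ⟨g, hg, hf.symm.trans hfg⟩

theorem add (h₁ : HasSimplePolarPartAt f₁ x r₁) (h₂ : HasSimplePolarPartAt f₂ x r₂) :
    HasSimplePolarPartAt (fun t => f₁ t + f₂ t) x (r₁ + r₂) := by
  obtain ⟨g₁, hg₁, hfg₁⟩ := h₁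
  obtain ⟨g₂, hg₂, hfg₂⟩ := h₂
  refine ⟨fun t => g₁ t + g₂ t, hg₁.fun_add hg₂, ?_⟩
  filter_upwards [hfg₁, hfg₂] with t ht₁ ht₂
  rw [ht₁, ht₂]
  ring

theorem const_mul (c : ℂ) (h : HasSimplePolarPartAt f x r) :
    HasSimplePolarPartAt (fun t => c * f t) x (c * r) := by
  obtain ⟨g, hg, hfg⟩ := h
  refine ⟨fun t => c * g t, analyticAt_const.fun_mul hg, ?_⟩
  filter_upwards [hfg] with t ht
  rw [ht]
  ring

theorem exists_eq_div_sub (h : HasSimplePolarPartAt f x r) :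
    ∃ g : ℂ → ℂ, AnalyticAt ℂ g x ∧ g x = r ∧ ∀ᶠ t in 𝓝[≠] x, f t = g t / (t - x) := by
  obtain ⟨g, hg, hfg⟩ := h
  refine ⟨fun t => r + (t - x) * g t, by fun_prop, by simp only [sub_self, zero_mul, add_zero], ?_⟩
  filter_upwards [hfg, self_mem_nhdsWithin] with t ht hne
  rw [ht, add_div, mul_div_cancel_left₀ _ (sub_ne_zero.2 hne)]

theorem meromorphicAt (h : HasSimplePolarPartAt f x r) : MeromorphicAt f x := by
  obtain ⟨g, hg, -, hfg⟩ := h.exists_eq_div_sub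
  have hdiv : MeromorphicAt (fun t => g t / (t - x)) x :=
    hg.meromorphicAt.fun_div (analyticAt_id.sub analyticAt_const).meromorphicAt
  exact hdiv.congr (EventuallyEq.symm hfg)

theorem meromorphicOrderAt_eq (h : HasSimplePolarPartAt f x r) (hr : r ≠ 0) :
    meromorphicOrderAt f x = ((-1 : ℤ) : WithTop ℤ) := by
  obtain ⟨g, hg, hgx, hfg⟩ := h.exists_eq_div_sub
  refine (meromorphicOrderAt_eq_int_iff h.meromorphicAt).2 ⟨g, hg, hgx ▸ hr, ?_⟩
  filter_upwards [hfg] with t ht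
  rw [ht, zpow_neg_one, smul_eq_mul, div_eq_inv_mul]

theorem meromorphicOrderAt_nonneg (h : HasSimplePolarPartAt f x 0) :
    0 ≤ meromorphicOrderAt f x := by
  obtain ⟨g, hg, hfg⟩ := h
  have hfg' : f =ᶠ[𝓝[≠] x] g := by
    filter_upwards [hfg] with t ht
    rw [ht, zero_div, zero_add]
  exact meromorphicOrderAt_congr hfg' ▸ hg.meromorphicOrderAt_nonneg

theorem meromorphicOrderAt_neg_iff (h : HasSimplePolarPartAt f x r) :
    meromorphicOrderAt f x < 0 ↔ r ≠ 0 := by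
  refine ⟨?_, fun hr => ?_⟩
  · rintro hlt rfl
    exact hlt.not_ge h.meromorphicOrderAt_nonneg
  · rw [h.meromorphicOrderAt_eq hr]
    exact WithTop.coe_lt_coe.2 neg_one_lt_zero

theorem eventually_circleIntegral_eq (h : HasSimplePolarPartAt f x r) :
    ∀ᶠ ε in 𝓝[>] (0 : ℝ), (2 * Real.pi * Complex.I)⁻¹ * (∮ t in C(x, ε), f t) = r := by
  obtain ⟨g, hg, rfl, hfg⟩ := h.exists_eq_div_sub
  obtain ⟨R, hR, hball⟩ := Metric.eventually_nhds_iff_ball.1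
    (hg.eventually_analyticAt.and (eventually_nhdsWithin_iff.1 hfg))
  filter_upwards [Ioo_mem_nhdsGT hR] with ε hε
  have hf : (∮ t in C(x, ε), f t) = ∮ t in C(x, ε), (t - x)⁻¹ • g t := by
    refine circleIntegral.integral_congr hε.1.le fun t ht => ?_
    have hlt : t ∈ Metric.ball x R := Metric.sphere_subset_ball hε.2 ht
    rw [(hball t hlt).2 (Metric.ne_of_mem_sphere ht hε.1.ne'), smul_eq_mul,
      div_eq_inv_mul]
  have hg' : DifferentiableOn ℂ g (Metric.closedBall x ε) := fun t ht =>
    (hball t (lt_of_le_of_lt ht hε.2)).1.differentiableAt.differentiableWithinAt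
  rw [hf, hg'.circleIntegral_sub_inv_smul (Metric.mem_ball_self hε.1), smul_eq_mul,
    inv_mul_cancel_left₀ Complex.two_pi_I_ne_zero]

end HasSimplePolarPartAt

theorem hasSimplePolarPartAt_logDeriv {f g : ℂ → ℂ} {x : ℂ} (n : ℤ) (hg : AnalyticAt ℂ g x)
    (hgx : g x ≠ 0) (hf : ∀ᶠ t in 𝓝[≠] x, f t = (t - x) ^ n * g t) :
    HasSimplePolarPartAt (logDeriv f) x n := by
  refine ⟨logDeriv g, hg.deriv.div hg hgx, (logDeriv_congr_nhdsNE hf).trans ?_⟩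
  have hg' : ∀ᶠ t in 𝓝 x, g t ≠ 0 ∧ DifferentiableAt ℂ g t :=
    (hg.continuousAt.eventually_ne hgx).and
      (hg.eventually_analyticAt.mono fun t ht => ht.differentiableAt)
  filter_upwards [hg'.filter_mono nhdsWithin_le_nhds, self_mem_nhdsWithin] with t ht hne
  have hsub : t - x ≠ 0 := sub_ne_zero.2 hne
  have hlin : HasDerivAt (fun t => t - x) 1 t := (hasDerivAt_id t).sub_const x
  have hpow : DifferentiableAt ℂ (fun t => (t - x) ^ n) t :=
    hlin.differentiableAt.zpow (Or.inl hsub)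
  rw [logDeriv_mul (f := fun t => (t - x) ^ n) t (zpow_ne_zero n hsub) ht.1 hpow ht.2,
    logDeriv_fun_zpow hlin.differentiableAt, logDeriv_apply (fun t => t - x), hlin.deriv,
    mul_one_div]

theorem hasSimplePolarPartAt_logDeriv_eval {Q : ℂ[X]} (hQ : Q ≠ 0) (a : ℂ) :
    HasSimplePolarPartAt (logDeriv fun t => Q.eval t) a (Q.rootMultiplicity a) := by
  obtain ⟨R, hQR, hR⟩ := exists_eq_pow_rootMultiplicity_mul_and_not_dvd Q hQ a
  refine hasSimplePolarPartAt_logDeriv (Q.rootMultiplicity a) (R.differentiable.analyticAt a)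
    (fun hRa => hR (dvd_iff_isRoot.2 hRa)) (Eventually.of_forall fun t => ?_)
  conv_lhs => rw [hQR]
  simp only [eval_mul, eval_pow, eval_sub, eval_X, eval_C, zpow_natCast]

theorem eval_reverse_of_ne_zero {K : Type*} [Field K] (Q : K[X]) {t : K} (ht : t ≠ 0) :
    Q.reverse.eval t = t ^ Q.natDegree * Q.eval t⁻¹ := by
  have := invertibleOfNonzero (inv_ne_zero ht)
  have h := eval₂_reverse_mul_pow (RingHom.id K) t⁻¹ Q
  rw [invOf_eq_inv, inv_inv, inv_pow, mul_inv_eq_iff_eq_mul₀ (pow_ne_zero _ ht)] at h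
  rwa [mul_comm]

theorem eval_zero_reverse {R : Type*} [Semiring R] (Q : R[X]) :
    Q.reverse.eval 0 = Q.leadingCoeff := by
  rw [← coeff_zero_eq_eval_zero, coeff_zero_reverse]

theorem hasSimplePolarPartAt_logDeriv_eval_inv {Q : ℂ[X]} (hQ : Q ≠ 0) :
    HasSimplePolarPartAt (logDeriv fun t => Q.eval t⁻¹) 0 (-Q.natDegree) := by
  have hpolar := hasSimplePolarPartAt_logDeriv (f := fun t => Q.eval t⁻¹) (-Q.natDegree)
    (Q.reverse.differentiable.analyticAt 0)
    (by rwa [eval_zero_reverse, leadingCoeff_ne_zero]) ?_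
  · exact_mod_cast hpolar
  filter_upwards [self_mem_nhdsWithin] with t ht
  rw [eval_reverse_of_ne_zero Q ht, sub_zero, zpow_neg, zpow_natCast,
    inv_mul_cancel_left₀ (pow_ne_zero _ ht)]

/-! ### The rational parametrisation -/

theorem eval_derivative_ne_zero_of_separable {R : Type*} [CommRing R] [Nontrivial R] {P : R[X]}
    (hP : P.Separable) {u : R} (hu : P.eval u = 0) : (derivative P).eval u ≠ 0 :=
  hP.eval₂_derivative_ne_zero (RingHom.id R) hu

/-- The parametrisation `z = u - α P(u) / P'(u)`, `w = P'(u) / (α P(u))` of the closure of the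
scaled symbol curve by `u = z + 1 / w` in the Riemann sphere. It is written with homogeneous
coordinates, which cover the roots of `P` and of `P'`. -/
noncomputable def symbolParam (P : ℂ[X]) (α : ℝ) : OnePoint ℂ → SphereSq
  | none => (OnePoint.infty, ((0 : ℂ) : OnePoint ℂ))
  | some u =>
    (RiemannSphere.ratio (u * (derivative P).eval u - α * P.eval u) ((derivative P).eval u),
      RiemannSphere.ratio ((derivative P).eval u) (α * P.eval u))

section Parametrisation

open RiemannSphere

variable {P : ℂ[X]} {α : ℝ}

theorem symbolParam_coe (P : ℂ[X]) (α : ℝ) (u : ℂ) : symbolParam P α (u : OnePoint ℂ) =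
    (ratio (u * (derivative P).eval u - α * P.eval u) ((derivative P).eval u),
      ratio ((derivative P).eval u) (α * P.eval u)) := rfl

theorem symbolParam_infty (P : ℂ[X]) (α : ℝ) : symbolParam P α OnePoint.infty =
    (OnePoint.infty, ((0 : ℂ) : OnePoint ℂ)) := rfl

theorem ofReal_mul_eval_reverse_zero_ne_zero (hP : P ≠ 0) (hα : α ≠ 0) :
    (α : ℂ) * P.reverse.eval 0 ≠ 0 := by
  rw [eval_zero_reverse]
  exact mul_ne_zero (Complex.ofReal_ne_zero.2 hα) (leadingCoeff_ne_zero.2 hP)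

theorem eval_reverse_derivative_sub_ne_zero (hP : P ≠ 0) (hαd : α ≠ P.natDegree) :
    (derivative P).reverse.eval 0 - α * P.reverse.eval 0 ≠ 0 := by
  rw [eval_zero_reverse, eval_zero_reverse, leadingCoeff_derivative, mul_comm P.leadingCoeff,
    ← sub_mul, ← neg_sub, neg_mul, neg_ne_zero]
  exact sub_natDegree_mul_leadingCoeff_ne_zero hP hαd

theorem symbolParam_inv_coe (hd : P.natDegree ≠ 0) (hα : α ≠ 0) (t : ℂ) :
    symbolParam P α (RiemannSphere.inv (t : OnePoint ℂ)) =
      (ratio ((derivative P).reverse.eval t - α * P.reverse.eval t)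
        (t * (derivative P).reverse.eval t),
      ratio (t * (derivative P).reverse.eval t) (α * P.reverse.eval t)) := by
  rcases eq_or_ne t 0 with rfl | ht
  · rw [inv_coe_zero, symbolParam_infty, zero_mul, ratio_zero_right, ratio_of_ne_zero _
      (ofReal_mul_eval_reverse_zero_ne_zero (ne_zero_of_natDegree_gt hd.pos) hα), zero_div]
  · have hpow : t ^ P.natDegree = t * t ^ (P.natDegree - 1) := (mul_pow_sub_one hd t).symm
    have hpow_ne : t ^ P.natDegree ≠ 0 := pow_ne_zero _ ht
    rw [inv_coe_of_ne_zero ht, symbolParam_coe, eval_reverse_of_ne_zero _ ht,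
      eval_reverse_of_ne_zero _ ht, natDegree_derivative, ← ratio_mul_left hpow_ne,
      ← ratio_mul_left hpow_ne (eval t⁻¹ (derivative P)), hpow]
    congr 2
    · field_simp
    all_goals ring

theorem mdifferentiable_symbolParam_fst (hd : P.natDegree ≠ 0) (hP : P.Separable) (hα : α ≠ 0)
    (hαd : α ≠ P.natDegree) : MDifferentiable 𝓘(ℂ) 𝓘(ℂ) fun p => (symbolParam P α p).1 := by
  intro p
  induction p using OnePoint.rec with
  | infty =>
    refine mdifferentiableAt_infty_of_comp ?_
    simp only [symbolParam_inv_coe hd hα]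
    exact mdifferentiableAt_ratio (by fun_prop) (by fun_prop)
      (Or.inl (eval_reverse_derivative_sub_ne_zero hP.ne_zero hαd))
  | coe u =>
    refine mdifferentiableAt_coe_of_comp ?_
    simp only [symbolParam_coe]
    refine mdifferentiableAt_ratio (by fun_prop) (by fun_prop) (or_iff_not_imp_right.2 ?_)
    intro hu
    have hu := not_not.1 hu
    rw [hu, mul_zero, zero_sub, neg_ne_zero]
    exact mul_ne_zero (Complex.ofReal_ne_zero.2 hα)
      fun hPu => eval_derivative_ne_zero_of_separable hP hPu hu

theorem mdifferentiable_symbolParam_snd (hd : P.natDegree ≠ 0) (hP : P.Separable) (hα : α ≠ 0) :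
    MDifferentiable 𝓘(ℂ) 𝓘(ℂ) fun p => (symbolParam P α p).2 := by
  intro p
  induction p using OnePoint.rec with
  | infty =>
    refine mdifferentiableAt_infty_of_comp ?_
    simp only [symbolParam_inv_coe hd hα]
    exact mdifferentiableAt_ratio (by fun_prop) (by fun_prop)
      (Or.inr (ofReal_mul_eval_reverse_zero_ne_zero hP.ne_zero hα))
  | coe u =>
    refine mdifferentiableAt_coe_of_comp ?_
    simp only [symbolParam_coe]
    refine mdifferentiableAt_ratio (by fun_prop) (by fun_prop) (or_iff_not_imp_left.2 ?_)
    intro hu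
    exact mul_ne_zero (Complex.ofReal_ne_zero.2 hα)
      fun hPu => hu (eval_derivative_ne_zero_of_separable hP hPu)

theorem continuous_symbolParam (hd : P.natDegree ≠ 0) (hP : P.Separable) (hα : α ≠ 0)
    (hαd : α ≠ P.natDegree) : Continuous (symbolParam P α) :=
  (mdifferentiable_symbolParam_fst hd hP hα hαd).continuous.prodMk
    (mdifferentiable_symbolParam_snd hd hP hα).continuous

theorem symbolParam_coe_of_eval_derivative_eq_zero (hP : P.Separable) (hα : α ≠ 0) {u : ℂ}
    (hu : (derivative P).eval u = 0) :
    symbolParam P α (u : OnePoint ℂ) = (OnePoint.infty, ((0 : ℂ) : OnePoint ℂ)) := by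
  have hPu : (α : ℂ) * P.eval u ≠ 0 := mul_ne_zero (Complex.ofReal_ne_zero.2 hα)
    fun hPu => eval_derivative_ne_zero_of_separable hP hPu hu
  rw [symbolParam_coe, ratio_of_ne_zero _ hPu, hu, ratio_zero_right, zero_div]

theorem symbolParam_coe_of_eval_eq_zero (hP : P.Separable) (α : ℝ) {u : ℂ} (hu : P.eval u = 0) :
    symbolParam P α (u : OnePoint ℂ) = ((u : OnePoint ℂ), OnePoint.infty) := by
  have hu' := eval_derivative_ne_zero_of_separable hP hu
  rw [symbolParam_coe, ratio_of_ne_zero _ hu', hu, mul_zero, ratio_zero_right, sub_zero,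
    mul_div_cancel_right₀ _ hu']

theorem symbolParam_coe_of_eval_ne_zero (hα : α ≠ 0) {u : ℂ} (hu : P.eval u ≠ 0)
    (hu' : (derivative P).eval u ≠ 0) : symbolParam P α (u : OnePoint ℂ) =
      (((u - α * P.eval u / (derivative P).eval u : ℂ) : OnePoint ℂ),
        (((derivative P).eval u / (α * P.eval u) : ℂ) : OnePoint ℂ)) := by
  rw [symbolParam_coe, ratio_of_ne_zero _ hu',
    ratio_of_ne_zero _ (mul_ne_zero (Complex.ofReal_ne_zero.2 hα) hu), sub_div,
    mul_div_cancel_right₀ _ hu']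

theorem symbolParam_fst_eq_infty_iff {p : OnePoint ℂ} :
    (symbolParam P α p).1 = OnePoint.infty ↔
      p = OnePoint.infty ∨ ∃ u : ℂ, (derivative P).eval u = 0 ∧ (u : OnePoint ℂ) = p := by
  induction p using OnePoint.rec with
  | infty => simp [symbolParam_infty]
  | coe u => simp [symbolParam_coe, ratio_eq_infty]

theorem symbolParam_snd_eq_infty_iff (hα : α ≠ 0) {p : OnePoint ℂ} :
    (symbolParam P α p).2 = OnePoint.infty ↔ ∃ u : ℂ, P.eval u = 0 ∧ (u : OnePoint ℂ) = p := by
  induction p using OnePoint.rec with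
  | infty => simp [symbolParam_infty]
  | coe u => simp [symbolParam_coe, ratio_eq_infty, hα]

theorem symbolParam_eq_infty_zero_iff (hP : P.Separable) (hα : α ≠ 0) {p : OnePoint ℂ} :
    symbolParam P α p = (OnePoint.infty, ((0 : ℂ) : OnePoint ℂ)) ↔
      p = OnePoint.infty ∨ ∃ u : ℂ, (derivative P).eval u = 0 ∧ (u : OnePoint ℂ) = p := by
  refine ⟨fun h => symbolParam_fst_eq_infty_iff.1 (congrArg Prod.fst h), ?_⟩
  rintro (rfl | ⟨u, hu, rfl⟩)
  · rfl
  · exact symbolParam_coe_of_eval_derivative_eq_zero hP hα hu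

theorem symbolParam_eq_coe_infty_iff (hP : P.Separable) (hα : α ≠ 0) {p : OnePoint ℂ} {z : ℂ}
    (hz : P.eval z = 0) :
    symbolParam P α p = ((z : OnePoint ℂ), OnePoint.infty) ↔ p = (z : OnePoint ℂ) := by
  constructor
  · intro h
    obtain ⟨u, hu, rfl⟩ := (symbolParam_snd_eq_infty_iff hα).1 (congrArg Prod.snd h)
    rw [symbolParam_coe_of_eval_eq_zero hP α hu] at h
    exact congrArg Prod.fst h
  · rintro rfl
    exact symbolParam_coe_of_eval_eq_zero hP α hz

theorem eq_of_symbolParam_eq (hP : P.Separable) (hα : α ≠ 0) {p q : OnePoint ℂ}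
    (hp : symbolParam P α p ≠ (OnePoint.infty, ((0 : ℂ) : OnePoint ℂ)))
    (hpq : symbolParam P α p = symbolParam P α q) : p = q := by
  have hq := hpq ▸ hp
  rw [Ne, symbolParam_eq_infty_zero_iff hP hα, not_or, not_exists] at hp hq
  obtain ⟨u, rfl⟩ := OnePoint.ne_infty_iff_exists.1 hp.1
  obtain ⟨v, rfl⟩ := OnePoint.ne_infty_iff_exists.1 hq.1
  have hu : (derivative P).eval u ≠ 0 := fun hu => hp.2 u ⟨hu, rfl⟩
  have hv : (derivative P).eval v ≠ 0 := fun hv => hq.2 v ⟨hv, rfl⟩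
  rw [symbolParam_coe, symbolParam_coe, Prod.mk.injEq, ratio_of_ne_zero _ hu,
    ratio_of_ne_zero _ hv, ratio_eq_inv hu, ratio_eq_inv hv, inv_involutive.injective.eq_iff,
    OnePoint.coe_eq_coe, OnePoint.coe_eq_coe, sub_div, sub_div, mul_div_cancel_right₀ _ hu,
    mul_div_cancel_right₀ _ hv] at hpq
  rw [OnePoint.coe_eq_coe]
  linear_combination hpq.1 + hpq.2

theorem evalEval_scaledSymbol_eq_zero_iff (hd : P.natDegree ≠ 0) (hP : P.Separable) (hα : α ≠ 0)
    (hαd : α ≠ P.natDegree) {z w : ℂ} : (scaledSymbol P α).evalEval z w = 0 ↔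
      ∃ u, P.eval u ≠ 0 ∧ (derivative P).eval u ≠ 0 ∧
        z = u - α * P.eval u / (derivative P).eval u ∧
        w = (derivative P).eval u / (α * P.eval u) := by
  have hα' : (α : ℂ) ≠ 0 := Complex.ofReal_ne_zero.2 hα
  rw [← coe_aevalAeval_eq_evalEval]
  constructor
  · intro h
    obtain ⟨v, hwv, hunit⟩ :=
      exists_isUnit_aeval_of_aevalAeval_scaledSymbol_eq_zero hd hP hα hαd h
    have hrel := (aevalAeval_scaledSymbol_eq_zero_iff hd hwv).1 h
    rw [isUnit_iff_ne_zero, coe_aeval_eq_eval, eval_mul, mul_ne_zero_iff] at hunit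
    simp only [Algebra.algebraMap_self_apply, coe_aeval_eq_eval] at hrel
    refine ⟨z + v, hunit.1, hunit.2, ?_, ?_⟩
    · rw [eq_sub_iff_add_eq, add_right_inj, div_eq_iff hunit.2, ← hrel]
      linear_combination (-α * P.eval (z + v)) * hwv
    · rw [eq_div_iff (mul_ne_zero hα' hunit.1), ← hrel]
      ring
  · rintro ⟨u, hu, hu', rfl, rfl⟩
    have hwv : (derivative P).eval u / (α * P.eval u) *
        (α * P.eval u / (derivative P).eval u) = 1 := by
      field_simp
    rw [aevalAeval_scaledSymbol_eq_zero_iff hd hwv, sub_add_cancel]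
    simp only [Algebra.algebraMap_self_apply, coe_aeval_eq_eval]
    field_simp

theorem setOf_evalEval_scaledSymbol_eq_zero (hd : P.natDegree ≠ 0) (hP : P.Separable) (hα : α ≠ 0)
    (hαd : α ≠ P.natDegree) :
    {p : SphereSq | ∃ z w : ℂ, (scaledSymbol P α).evalEval z w = 0 ∧
        p = ((z : OnePoint ℂ), (w : OnePoint ℂ))} =
      symbolParam P α '' ((↑) '' {u : ℂ | P.eval u ≠ 0 ∧ (derivative P).eval u ≠ 0}) := by
  ext p
  simp only [evalEval_scaledSymbol_eq_zero_iff hd hP hα hαd, Set.image_image, Set.mem_image,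
    Set.mem_ofPred_eq]
  constructor
  · rintro ⟨_, _, ⟨u, hu, hu', rfl, rfl⟩, rfl⟩
    exact ⟨u, ⟨hu, hu'⟩, symbolParam_coe_of_eval_ne_zero hα hu hu'⟩
  · rintro ⟨u, ⟨hu, hu'⟩, rfl⟩
    exact ⟨_, _, ⟨u, hu, hu', rfl, rfl⟩, symbolParam_coe_of_eval_ne_zero hα hu hu'⟩

theorem dense_setOf_eval_ne_zero {Q : ℂ[X]} (hQ : Q ≠ 0) : Dense {u : ℂ | Q.eval u ≠ 0} :=
  (finite_setOfPred_isRoot hQ).countable.dense_compl ℝ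

theorem range_symbolParam (hd : P.natDegree ≠ 0) (hP : P.Separable) (hα : α ≠ 0)
    (hαd : α ≠ P.natDegree) :
    Set.range (symbolParam P α) = curveClosure (scaledSymbol P α) := by
  have hcont := continuous_symbolParam hd hP hα hαd
  have hdense : Dense {u : ℂ | P.eval u ≠ 0 ∧ (derivative P).eval u ≠ 0} := by
    simpa only [eval_mul, mul_ne_zero_iff] using
      dense_setOf_eval_ne_zero (mul_derivative_ne_zero hd)
  rw [curveClosure, setOf_evalEval_scaledSymbol_eq_zero hd hP hα hαd]
  refine Set.Subset.antisymm ?_ (closure_minimal (Set.image_subset_range _ _)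
    (isCompact_range hcont).isClosed)
  rw [← Set.image_univ,
    ← (OnePoint.denseRange_coe.dense_image OnePoint.continuous_coe hdense).closure_eq]
  exact image_closure_subset_closure_image hcont

theorem setOf_symbolParam_eq_infty_zero (hP : P.Separable) (hα : α ≠ 0) :
    {p | symbolParam P α p = (OnePoint.infty, ((0 : ℂ) : OnePoint ℂ))} =
      insert OnePoint.infty ((↑) '' {u : ℂ | (derivative P).eval u = 0}) :=
  Set.ext fun _ => symbolParam_eq_infty_zero_iff hP hα

theorem isNormalisation_symbolParam (hd : P.natDegree ≠ 0) (hP : P.Separable) (hα : α ≠ 0)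
    (hαd : α ≠ P.natDegree) : IsNormalisation (scaledSymbol P α) (symbolParam P α) where
  isManifold := inferInstance
  compact := inferInstance
  t2 := inferInstance
  connected := inferInstance
  holomorphic_fst := mdifferentiable_symbolParam_fst hd hP hα hαd
  holomorphic_snd := mdifferentiable_symbolParam_snd hd hP hα
  range_eq := range_symbolParam hd hP hα hαd
  finite_nonInjective := by
    have hfin : {p | symbolParam P α p = (OnePoint.infty, ((0 : ℂ) : OnePoint ℂ))}.Finite := by
      rw [setOf_symbolParam_eq_infty_zero hP hα]
      exact ((finite_setOfPred_isRoot (mt derivative_eq_zero.1 hd)).image _).insert _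
    refine hfin.subset ?_
    rintro p ⟨q, hqp, hq⟩
    by_contra hp
    exact hqp (eq_of_symbolParam_eq hP hα hp hq.symm).symm

theorem existsUnique_symbolParam_eq (hd : P.natDegree ≠ 0) (hP : P.Separable) (hα : α ≠ 0)
    (hαd : α ≠ P.natDegree) {x : SphereSq} (hx : x ∈ curveClosure (scaledSymbol P α))
    (hx' : x ≠ (OnePoint.infty, ((0 : ℂ) : OnePoint ℂ))) : ∃! p, symbolParam P α p = x := by
  rw [← range_symbolParam hd hP hα hαd] at hx
  obtain ⟨p, rfl⟩ := hx
  exact ⟨p, rfl, fun q hq => (eq_of_symbolParam_eq hP hα hx' hq.symm).symm⟩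

theorem setOf_mem_curveClosure_scaledSymbol_fst_eq_infty (hd : P.natDegree ≠ 0) (hP : P.Separable)
    (hα : α ≠ 0) (hαd : α ≠ P.natDegree) :
    {p ∈ curveClosure (scaledSymbol P α) | p.1 = OnePoint.infty} =
      {(OnePoint.infty, ((0 : ℂ) : OnePoint ℂ))} := by
  rw [← range_symbolParam hd hP hα hαd]
  refine Set.Subset.antisymm ?_ (Set.singleton_subset_iff.2 ⟨⟨OnePoint.infty, rfl⟩, rfl⟩)
  rintro _ ⟨⟨p, rfl⟩, hp⟩
  exact (symbolParam_eq_infty_zero_iff hP hα).2 (symbolParam_fst_eq_infty_iff.1 hp)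

theorem singularPoints_scaledSymbol (hd : 2 ≤ P.natDegree) (hP : P.Separable) (hα : α ≠ 0)
    (hαd : α ≠ P.natDegree) :
    singularPoints (scaledSymbol P α) = {(OnePoint.infty, ((0 : ℂ) : OnePoint ℂ))} := by
  have hd₀ : P.natDegree ≠ 0 := by lia
  rw [singularPoints, ← range_symbolParam hd₀ hP hα hαd]
  refine Set.Subset.antisymm ?_ (Set.singleton_subset_iff.2 ⟨⟨OnePoint.infty, rfl⟩,
    (hasSlopePolynomial_scaledSymbol hd₀ hα).fderiv_eq_zero hd⟩)
  rintro _ ⟨⟨p, rfl⟩, hp⟩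
  rw [Set.mem_singleton_iff, symbolParam_eq_infty_zero_iff hP hα]
  by_contra! h
  obtain ⟨u, rfl⟩ := OnePoint.ne_infty_iff_exists.1 h.1
  have hu' : (derivative P).eval u ≠ 0 := fun hu' => h.2 u hu' rfl
  by_cases hu : P.eval u = 0
  · rw [symbolParam_coe_of_eval_eq_zero hP α hu] at hp
    refine fderiv_evalEval_reverse_scaledSymbol_ne_zero hα hu' ?_
    simpa [localEquation, coord_coe, coord_infty] using hp
  · rw [symbolParam_coe_of_eval_ne_zero hα hu hu'] at hp
    refine fderiv_evalEval_scaledSymbol_ne_zero hd₀ hP hα hαd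
      ((evalEval_scaledSymbol_eq_zero_iff hd₀ hP hα hαd).2 ⟨u, hu, hu', rfl, rfl⟩) ?_
    simpa [localEquation, coord_coe] using hp

end Parametrisation

/-! ### The form `w dz` and its residues -/

section Form

open RiemannSphere

variable {P : ℂ[X]} {α : ℝ}

/-- The coefficient of `w dz` in the parameter `u`: the logarithmic derivative of the multivalued
function `P ^ ((1 - α) / α) * P'`. -/
noncomputable def symbolForm (P : ℂ[X]) (α : ℝ) (u : ℂ) : ℂ :=
  (1 - α) / α * logDeriv (fun v => P.eval v) u + logDeriv (fun v => (derivative P).eval v) u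

theorem div_mul_deriv_div_eq_logDeriv_add {x : ℂ → ℂ} {t : ℂ} (hα : α ≠ 0)
    (hx : DifferentiableAt ℂ x t) (hu : P.eval (x t) ≠ 0) (hu' : (derivative P).eval (x t) ≠ 0) :
    (derivative P).eval (x t) / (α * P.eval (x t)) *
        deriv (fun s => (x s * (derivative P).eval (x s) - α * P.eval (x s)) /
          (derivative P).eval (x s)) t =
      (1 - α) / α * logDeriv (fun s => P.eval (x s)) t +
        logDeriv (fun s => (derivative P).eval (x s)) t := by
  have hα' : (α : ℂ) ≠ 0 := Complex.ofReal_ne_zero.2 hα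
  have heval (Q : ℂ[X]) :
      HasDerivAt (fun s => Q.eval (x s)) ((derivative Q).eval (x t) * deriv x t) t :=
    (Q.hasDerivAt (x t)).comp t hx.hasDerivAt
  have hz := ((hx.hasDerivAt.fun_mul (heval (derivative P))).fun_sub
    ((heval P).const_mul (α : ℂ))).fun_div (heval (derivative P)) hu'
  rw [hz.deriv, logDeriv_apply, logDeriv_apply, (heval P).deriv, (heval (derivative P)).deriv]
  field_simp
  ring

theorem eventually_cofinite_eval_ne_zero {Q : ℂ[X]} (hQ : Q ≠ 0) :
    ∀ᶠ u in cofinite, Q.eval u ≠ 0 :=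
  (finite_setOfPred_isRoot hQ).eventually_cofinite_notMem

theorem eventuallyEq_formCoeff_symbolParam_coe (hd : P.natDegree ≠ 0) (hα : α ≠ 0) (a : ℂ) :
    formCoeff (symbolParam P α) (a : OnePoint ℂ) =ᶠ[𝓝[≠] a] symbolForm P α := by
  filter_upwards [nhdsNE_le_cofinite a
    (eventually_cofinite_eval_ne_zero (mul_derivative_ne_zero hd))] with t ht
  rw [eval_mul, mul_ne_zero_iff] at ht
  simp only [formCoeff, chartAt_coe, finiteChart_symm_apply, symbolParam_coe, coord_ratio]
  exact div_mul_deriv_div_eq_logDeriv_add hα differentiableAt_id ht.1 ht.2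

theorem eventuallyEq_formCoeff_symbolParam_infty (hd : P.natDegree ≠ 0) (hα : α ≠ 0) :
    formCoeff (symbolParam P α) OnePoint.infty =ᶠ[𝓝[≠] 0] fun t =>
      (1 - α) / α * logDeriv (fun s => P.eval s⁻¹) t +
        logDeriv (fun s => (derivative P).eval s⁻¹) t := by
  have hne : ∀ᶠ t : ℂ in 𝓝[≠] 0, (P * derivative P).eval t⁻¹ ≠ 0 :=
    (tendsto_inv₀_nhdsNE_zero.mono_right (Bornology.le_cofinite ℂ)).eventually
      (eventually_cofinite_eval_ne_zero (mul_derivative_ne_zero hd))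
  filter_upwards [hne, self_mem_nhdsWithin] with t hPt ht
  rw [eval_mul, mul_ne_zero_iff] at hPt
  have hz : (fun s : ℂ => coord (symbolParam P α (RiemannSphere.inv (s : OnePoint ℂ))).1) =ᶠ[𝓝 t]
      fun s => (s⁻¹ * (derivative P).eval s⁻¹ - α * P.eval s⁻¹) / (derivative P).eval s⁻¹ := by
    filter_upwards [isOpen_ne.mem_nhds ht] with s hs
    rw [inv_coe_of_ne_zero hs, symbolParam_coe, coord_ratio]
  simp only [formCoeff, chartAt_infty, inftyChart_symm_apply]
  rw [hz.deriv_eq, inv_coe_of_ne_zero ht, symbolParam_coe, coord_ratio]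
  exact div_mul_deriv_div_eq_logDeriv_add hα (differentiableAt_inv ht) hPt.1 hPt.2

/-- The residue of `w dz` at a point of the parametrising sphere: the order of
`P ^ ((1 - α) / α) * P'` there. -/
noncomputable def symbolResidue (P : ℂ[X]) (α : ℝ) : OnePoint ℂ → ℂ
  | none => (α - P.natDegree) / α
  | some u => (1 - α) / α * P.rootMultiplicity u + (derivative P).rootMultiplicity u

theorem hasSimplePolarPartAt_formCoeff_symbolParam (hd : P.natDegree ≠ 0) (hα : α ≠ 0)
    (p : OnePoint ℂ) :
    HasSimplePolarPartAt (formCoeff (symbolParam P α) p) (chartAt ℂ p p) (symbolResidue P α p) := by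
  have hP := left_ne_zero_of_mul (mul_derivative_ne_zero hd)
  have hP' := right_ne_zero_of_mul (mul_derivative_ne_zero hd)
  induction p using OnePoint.rec with
  | infty =>
    have hres : symbolResidue P α OnePoint.infty =
        (1 - α) / α * (-P.natDegree) + -(derivative P).natDegree := by
      have hα' : (α : ℂ) ≠ 0 := Complex.ofReal_ne_zero.2 hα
      change (α - P.natDegree : ℂ) / α = _
      rw [natDegree_derivative, Nat.cast_pred hd.pos]
      field_simp
      ring
    rw [chartAt_infty_apply_self, hres]
    exact (((hasSimplePolarPartAt_logDeriv_eval_inv hP).const_mul _).add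
      (hasSimplePolarPartAt_logDeriv_eval_inv hP')).congr
        (eventuallyEq_formCoeff_symbolParam_infty hd hα).symm
  | coe u =>
    rw [chartAt_coe_apply_self]
    exact (((hasSimplePolarPartAt_logDeriv_eval hP u).const_mul _).add
      (hasSimplePolarPartAt_logDeriv_eval hP' u)).congr
        (eventuallyEq_formCoeff_symbolParam_coe hd hα u).symm

theorem rootMultiplicity_eq_one_of_separable {R : Type*} [CommRing R] [Nontrivial R] {Q : R[X]}
    (hQ : Q.Separable) {u : R} (hu : Q.eval u = 0) : Q.rootMultiplicity u = 1 :=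
  le_antisymm (rootMultiplicity_le_one_of_separable hQ u)
    ((rootMultiplicity_pos hQ.ne_zero).2 hu)

theorem symbolResidue_coe_of_eval_eq_zero (hP : P.Separable) (α : ℝ) {u : ℂ}
    (hu : P.eval u = 0) : symbolResidue P α (u : OnePoint ℂ) = (1 - α) / α := by
  change (1 - α) / α * (P.rootMultiplicity u : ℂ) + (derivative P).rootMultiplicity u = _
  rw [rootMultiplicity_eq_one_of_separable hP hu,
    rootMultiplicity_eq_zero (eval_derivative_ne_zero_of_separable hP hu), Nat.cast_one,
    Nat.cast_zero, mul_one, add_zero]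

theorem symbolResidue_coe_of_eval_derivative_eq_zero (hP : P.Separable)
    (hP' : (derivative P).Separable) (α : ℝ) {u : ℂ} (hu : (derivative P).eval u = 0) :
    symbolResidue P α (u : OnePoint ℂ) = 1 := by
  change (1 - α) / α * (P.rootMultiplicity u : ℂ) + (derivative P).rootMultiplicity u = _
  rw [rootMultiplicity_eq_one_of_separable hP' hu,
    rootMultiplicity_eq_zero fun h => eval_derivative_ne_zero_of_separable hP h hu, Nat.cast_zero,
    Nat.cast_one, mul_zero, zero_add]

theorem symbolResidue_coe_of_eval_ne_zero (α : ℝ) {u : ℂ} (hu : P.eval u ≠ 0)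
    (hu' : (derivative P).eval u ≠ 0) : symbolResidue P α (u : OnePoint ℂ) = 0 := by
  change (1 - α) / α * (P.rootMultiplicity u : ℂ) + (derivative P).rootMultiplicity u = _
  rw [rootMultiplicity_eq_zero hu, rootMultiplicity_eq_zero hu', Nat.cast_zero, mul_zero, add_zero]

theorem symbolResidue_ne_zero_iff (hP : P.Separable) (hP' : (derivative P).Separable)
    (hα : α ≠ 0) (hαd : α ≠ P.natDegree) {p : OnePoint ℂ} :
    symbolResidue P α p ≠ 0 ↔
      symbolParam P α p = (OnePoint.infty, ((0 : ℂ) : OnePoint ℂ)) ∨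
        (α ≠ 1 ∧ ∃ z : ℂ, P.IsRoot z ∧ symbolParam P α p = ((z : OnePoint ℂ), OnePoint.infty)) := by
  have hα' : (α : ℂ) ≠ 0 := Complex.ofReal_ne_zero.2 hα
  induction p using OnePoint.rec with
  | infty =>
    refine iff_of_true (div_ne_zero (sub_ne_zero.2 ?_) hα') (Or.inl rfl)
    exact_mod_cast hαd
  | coe u =>
    by_cases hu' : (derivative P).eval u = 0
    · rw [symbolResidue_coe_of_eval_derivative_eq_zero hP hP' α hu']
      exact iff_of_true one_ne_zero
        (Or.inl (symbolParam_coe_of_eval_derivative_eq_zero hP hα hu'))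
    by_cases hu : P.eval u = 0
    · rw [symbolResidue_coe_of_eval_eq_zero hP α hu, symbolParam_coe_of_eval_eq_zero hP α hu,
        div_ne_zero_iff, and_iff_left hα', sub_ne_zero, ne_comm]
      simp [hu]
    · rw [symbolResidue_coe_of_eval_ne_zero α hu hu', symbolParam_coe_of_eval_ne_zero hα hu hu']
      simp

theorem meromorphicAt_formCoeff_symbolParam (hd : P.natDegree ≠ 0) (hα : α ≠ 0)
    (p : OnePoint ℂ) : MeromorphicAt (formCoeff (symbolParam P α) p) (chartAt ℂ p p) :=
  (hasSimplePolarPartAt_formCoeff_symbolParam hd hα p).meromorphicAt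

theorem formOrder_symbolParam_neg_iff_symbolResidue_ne_zero (hd : P.natDegree ≠ 0) (hα : α ≠ 0)
    {p : OnePoint ℂ} : formOrder (symbolParam P α) p < 0 ↔ symbolResidue P α p ≠ 0 :=
  (hasSimplePolarPartAt_formCoeff_symbolParam hd hα p).meromorphicOrderAt_neg_iff

theorem formOrder_symbolParam_neg_iff (hd : P.natDegree ≠ 0) (hP : P.Separable)
    (hP' : (derivative P).Separable) (hα : α ≠ 0) (hαd : α ≠ P.natDegree) {p : OnePoint ℂ} :
    formOrder (symbolParam P α) p < 0 ↔
      symbolParam P α p = (OnePoint.infty, ((0 : ℂ) : OnePoint ℂ)) ∨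
        (α ≠ 1 ∧ ∃ z : ℂ, P.IsRoot z ∧ symbolParam P α p = ((z : OnePoint ℂ), OnePoint.infty)) :=
  (formOrder_symbolParam_neg_iff_symbolResidue_ne_zero hd hα).trans
    (symbolResidue_ne_zero_iff hP hP' hα hαd)

theorem formOrder_symbolParam_eq_neg_one (hd : P.natDegree ≠ 0) (hα : α ≠ 0) {p : OnePoint ℂ}
    (hp : formOrder (symbolParam P α) p < 0) :
    formOrder (symbolParam P α) p = ((-1 : ℤ) : WithTop ℤ) :=
  (hasSimplePolarPartAt_formCoeff_symbolParam hd hα p).meromorphicOrderAt_eq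
    ((formOrder_symbolParam_neg_iff_symbolResidue_ne_zero hd hα).1 hp)

theorem hasFormResidue_symbolParam (hd : P.natDegree ≠ 0) (hα : α ≠ 0) (p : OnePoint ℂ) :
    HasFormResidue (symbolParam P α) p (symbolResidue P α p) :=
  (hasSimplePolarPartAt_formCoeff_symbolParam hd hα p).eventually_circleIntegral_eq

theorem hasFormResidue_of_symbolParam_eq_coe_infty (hd : P.natDegree ≠ 0) (hP : P.Separable)
    (hα : α ≠ 0) {z : ℂ} (hz : P.eval z = 0) {p : OnePoint ℂ}
    (hp : symbolParam P α p = ((z : OnePoint ℂ), OnePoint.infty)) :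
    HasFormResidue (symbolParam P α) p ((1 - α) / α) := by
  rw [symbolParam_eq_coe_infty_iff hP hα hz] at hp
  rw [hp, ← symbolResidue_coe_of_eval_eq_zero hP α hz]
  exact hasFormResidue_symbolParam hd hα _

end Form

/-! ### The branches at `(∞, 0)` -/

section Branches

open RiemannSphere

theorem isSmoothBranchAtInfty_of_eventually_eq {M : Type} [TopologicalSpace M]
    {ν : M → SphereSq} {p : M} {σ : ℂ → M} {y k : ℂ → ℂ} {x : ℂ} (hσ : map σ (𝓝 x) = 𝓝 p)
    (hy : AnalyticAt ℂ y x) (hyx : y x = 0) (hy' : deriv y x ≠ 0) (hk : AnalyticAt ℂ k x)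
    (hν : ∀ᶠ t in 𝓝 x, ν (σ t) =
      (RiemannSphere.inv (y t : OnePoint ℂ), ((y t * k t : ℂ) : OnePoint ℂ))) :
    IsSmoothBranchAtInfty ν p (k x) := by
  let φ := hy.hasStrictDerivAt.localInverse _ _ _ hy'
  have hφ : AnalyticAt ℂ φ 0 := hyx ▸ hy.analyticAt_localInverse hy'
  have hφ0 : φ 0 = x := by
    rw [← hyx]
    exact HasStrictFDerivAt.localInverse_apply_image ..
  have hφy : ∀ᶠ t in 𝓝 x, φ (y t) = t := hy.hasStrictDerivAt.eventually_left_inverse hy'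
  have hmap : map y (𝓝 x) = 𝓝 0 := hyx ▸ hy.hasStrictDerivAt.map_nhds_eq hy'
  have hkφ : AnalyticAt ℂ (fun s => k (φ s)) 0 := AnalyticAt.fun_comp (hφ0.symm ▸ hk) hφ
  refine ⟨fun s => s * k (φ s), analyticAt_id.fun_mul hkφ, zero_mul _, ?_, ?_⟩
  · have hderiv := ((hasDerivAt_id (0 : ℂ)).fun_mul hkφ.differentiableAt.hasDerivAt).deriv
    simpa only [id_eq, one_mul, zero_mul, add_zero, hφ0] using hderiv
  · rw [← hσ, ← hmap, map_map, map_map]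
    refine Filter.map_congr ?_
    filter_upwards [hν, hφy] with t ht hφt
    simp only [Function.comp_apply, ht, hφt]

theorem isSmoothBranchAtInfty_of_eq_ratio {M : Type} [TopologicalSpace M]
    {ν : M → SphereSq} {p : M} {σ : ℂ → M} {a b c : ℂ → ℂ} {x : ℂ} (hσ : map σ (𝓝 x) = 𝓝 p)
    (ha : AnalyticAt ℂ a x) (hax : a x ≠ 0) (hb : AnalyticAt ℂ b x) (hbx : b x = 0)
    (hb' : deriv b x ≠ 0) (hc : AnalyticAt ℂ c x) (hcx : c x ≠ 0)
    (hν : ∀ t, ν (σ t) = (ratio (a t) (b t), ratio (b t) (c t))) :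
    IsSmoothBranchAtInfty ν p (a x / c x) := by
  refine isSmoothBranchAtInfty_of_eventually_eq (y := fun t => b t / a t)
    (k := fun t => a t / c t) hσ (hb.fun_div ha hax) ?_ ?_ (ha.fun_div hc hcx) ?_
  · rw [hbx, zero_div]
  · rw [deriv_fun_div hb.differentiableAt ha.differentiableAt hax, hbx, zero_mul, sub_zero]
    exact div_ne_zero (mul_ne_zero hb' hax) (pow_ne_zero 2 hax)
  · filter_upwards [ha.continuousAt.eventually_ne hax, hc.continuousAt.eventually_ne hcx]
      with t hat hct
    rw [hν, ratio_eq_inv hat, ratio_of_ne_zero _ hct, div_mul_div_cancel₀ hat]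

variable {P : ℂ[X]} {α : ℝ}

theorem isSmoothBranchAtInfty_symbolParam_coe (hP : P.Separable) (hP' : (derivative P).Separable)
    (hα : α ≠ 0) {u : ℂ} (hu : (derivative P).eval u = 0) :
    IsSmoothBranchAtInfty (symbolParam P α) (u : OnePoint ℂ) (-1) := by
  have hPu : (α : ℂ) * P.eval u ≠ 0 := mul_ne_zero (Complex.ofReal_ne_zero.2 hα)
    fun hPu => eval_derivative_ne_zero_of_separable hP hPu hu
  have hnum : u * (derivative P).eval u - α * P.eval u = -(α * P.eval u) := by
    rw [hu, mul_zero, zero_sub]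
  have hslope : (-1 : ℂ) = (u * (derivative P).eval u - α * P.eval u) / (α * P.eval u) := by
    rw [hnum, neg_div, div_self hPu]
  rw [hslope]
  have heval (Q : ℂ[X]) : AnalyticAt ℂ (fun t => Q.eval t) u := Q.differentiable.analyticAt u
  refine isSmoothBranchAtInfty_of_eq_ratio
    (a := fun t => t * (derivative P).eval t - α * P.eval t) (b := fun t => (derivative P).eval t)
    (c := fun t => α * P.eval t) (OnePoint.nhds_coe_eq u).symm
    ((analyticAt_id.fun_mul (heval (derivative P))).fun_sub
      (analyticAt_const.fun_mul (heval P)))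
    (hnum ▸ neg_ne_zero.2 hPu) (heval (derivative P)) hu ?_
    (analyticAt_const.fun_mul (heval P)) hPu (symbolParam_coe P α)
  rw [Polynomial.deriv]
  exact eval_derivative_ne_zero_of_separable hP' hu

theorem isSmoothBranchAtInfty_symbolParam_infty (hd : P.natDegree ≠ 0) (hα : α ≠ 0)
    (hαd : α ≠ P.natDegree) :
    IsSmoothBranchAtInfty (symbolParam P α) OnePoint.infty (P.natDegree / α - 1) := by
  have hP : P ≠ 0 := ne_zero_of_natDegree_gt hd.pos
  have hPα := ofReal_mul_eval_reverse_zero_ne_zero hP hα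
  have hslope : (P.natDegree / α - 1 : ℂ) =
      ((derivative P).reverse.eval 0 - α * P.reverse.eval 0) / (α * P.reverse.eval 0) := by
    have hlead : P.leadingCoeff ≠ 0 := leadingCoeff_ne_zero.2 hP
    rw [sub_div, div_self hPα, eval_zero_reverse, eval_zero_reverse, leadingCoeff_derivative,
      mul_comm (α : ℂ), mul_div_mul_left _ _ hlead]
  rw [hslope]
  have heval (Q : ℂ[X]) : AnalyticAt ℂ (fun t => Q.eval t) 0 := Q.differentiable.analyticAt 0
  refine isSmoothBranchAtInfty_of_eq_ratio
    (a := fun t => (derivative P).reverse.eval t - α * P.reverse.eval t)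
    (b := fun t => t * (derivative P).reverse.eval t) (c := fun t => α * P.reverse.eval t)
    nhds_infty_eq_map.symm
    ((heval (derivative P).reverse).fun_sub (analyticAt_const.fun_mul (heval P.reverse)))
    (eval_reverse_derivative_sub_ne_zero hP hαd)
    (analyticAt_id.fun_mul (heval (derivative P).reverse)) (zero_mul _) ?_
    (analyticAt_const.fun_mul (heval P.reverse)) hPα (symbolParam_inv_coe hd hα)
  have hderiv := ((hasDerivAt_id (0 : ℂ)).fun_mul ((derivative P).reverse.hasDerivAt 0)).deriv
  simp only [id_eq, one_mul, zero_mul, add_zero] at hderiv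
  rw [hderiv, eval_zero_reverse, leadingCoeff_ne_zero]
  exact mt derivative_eq_zero.1 hd

end Branches

/-! ### Periods -/

theorem hasDerivAt_log_norm {f : ℝ → ℂ} {f' : ℂ} {t : ℝ} (hf : HasDerivAt f f' t)
    (ht : f t ≠ 0) : HasDerivAt (fun s => Real.log ‖f s‖) (f' / f t).re t := by
  have hquot : HasDerivAt (fun s => f s / f t) (f' / f t) t := hf.div_const _
  have hlog : HasDerivAt (fun s => Complex.log (f s / f t)) (f' / f t) t := by
    simpa only [div_self ht, div_one] using
      hquot.clog_real (by simpa only [div_self ht] using Complex.one_mem_slitPlane)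
  refine ((Complex.reCLM.hasFDerivAt.comp_hasDerivAt t hlog).add_const
    (Real.log ‖f t‖)).congr_of_eventuallyEq ?_
  filter_upwards [hf.continuousAt.eventually_ne ht] with s hs
  rw [Function.comp_apply, Complex.reCLM_apply, Complex.log_re, norm_div,
    Real.log_div (norm_ne_zero_iff.2 hs) (norm_ne_zero_iff.2 ht), sub_add_cancel]

theorem intervalIntegrable_derivWithin_div {f : ℝ → ℂ} {a b : ℝ} (hab : a < b)
    (hf : ContDiffOn ℝ 1 f (Set.Icc a b)) (hf₀ : ∀ t ∈ Set.Icc a b, f t ≠ 0) :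
    IntervalIntegrable (fun t => derivWithin f (Set.Icc a b) t / f t) MeasureTheory.volume a b := by
  refine ContinuousOn.intervalIntegrable ?_
  rw [Set.uIcc_of_le hab.le]
  exact (hf.continuousOn_derivWithin (uniqueDiffOn_Icc hab) le_rfl).div hf.continuousOn hf₀

theorem re_integral_derivWithin_div {f : ℝ → ℂ} {a b : ℝ} (hab : a < b)
    (hf : ContDiffOn ℝ 1 f (Set.Icc a b)) (hf₀ : ∀ t ∈ Set.Icc a b, f t ≠ 0) :
    (∫ t in a..b, derivWithin f (Set.Icc a b) t / f t).re = Real.log ‖f b‖ - Real.log ‖f a‖ := by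
  have hint := intervalIntegrable_derivWithin_div hab hf hf₀
  rw [← Complex.reCLM_apply, ← Complex.reCLM.intervalIntegral_comp_comm hint]
  refine intervalIntegral.integral_eq_sub_of_hasDerivAt_of_le hab.le
    (hf.continuousOn.norm.log fun t ht => norm_ne_zero_iff.2 (hf₀ t ht)) (fun t ht => ?_)
    ⟨Complex.reCLM.integrable_comp hint.1, Complex.reCLM.integrable_comp hint.2⟩
  have ht' := Set.Ioo_subset_Icc_self ht
  have hderiv : HasDerivAt f (derivWithin f (Set.Icc a b) t) t :=
    (hf.differentiableOn one_ne_zero t ht').hasDerivWithinAt.hasDerivAt (Icc_mem_nhds ht.1 ht.2)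
  exact hasDerivAt_log_norm hderiv (hf₀ t ht')

theorem logDeriv_eval_mul_derivWithin (Q : ℂ[X]) {g : ℝ → ℂ} {s : Set ℝ} {t : ℝ}
    (hg : DifferentiableWithinAt ℝ g s t) (hs : UniqueDiffWithinAt ℝ s t) :
    logDeriv (fun v => Q.eval v) (g t) * derivWithin g s t =
      derivWithin (fun r => Q.eval (g r)) s t / Q.eval (g t) := by
  have hcomp : HasDerivWithinAt (fun r => Q.eval (g r))
      ((derivative Q).eval (g t) * derivWithin g s t) s t :=
    (Q.hasDerivAt (g t)).comp_hasDerivWithinAt t hg.hasDerivWithinAt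
  rw [hcomp.derivWithin hs, logDeriv_apply, Polynomial.deriv, div_mul_eq_mul_div]

section PolynomialPath

variable {Q : ℂ[X]} {g : ℝ → ℂ} {a b : ℝ}

theorem contDiffOn_eval_comp {n : WithTop ℕ∞} {s : Set ℝ} (Q : ℂ[X]) (hg : ContDiffOn ℝ n g s) :
    ContDiffOn ℝ n (fun t => Q.eval (g t)) s := by
  have hQ : ContDiff ℂ n fun v => Q.eval v := by
    simpa only [coe_aeval_eq_eval] using Q.contDiff_aeval (𝕜 := ℂ) n
  exact (hQ.restrict_scalars ℝ).comp_contDiffOn hg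

theorem eqOn_logDeriv_eval_mul_derivWithin (Q : ℂ[X]) (hab : a < b)
    (hg : ContDiffOn ℝ 1 g (Set.Icc a b)) :
    Set.EqOn (fun t => logDeriv (fun v => Q.eval v) (g t) * derivWithin g (Set.Icc a b) t)
      (fun t => derivWithin (fun r => Q.eval (g r)) (Set.Icc a b) t / Q.eval (g t))
      (Set.uIcc a b) := by
  rw [Set.uIcc_of_le hab.le]
  exact fun t ht => logDeriv_eval_mul_derivWithin Q (hg.differentiableOn one_ne_zero t ht)
    (uniqueDiffOn_Icc hab t ht)

theorem intervalIntegrable_mul_logDeriv_eval {c : ℂ} (hab : a < b)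
    (hg : ContDiffOn ℝ 1 g (Set.Icc a b)) (hQ : c = 0 ∨ ∀ t ∈ Set.Icc a b, Q.eval (g t) ≠ 0) :
    IntervalIntegrable
      (fun t => c * (logDeriv (fun v => Q.eval v) (g t) * derivWithin g (Set.Icc a b) t))
      MeasureTheory.volume a b := by
  rcases hQ with rfl | hQ
  · simp only [zero_mul]
    exact IntervalIntegrable.zero
  · exact ((intervalIntegrable_derivWithin_div hab (contDiffOn_eval_comp Q hg) hQ).congr
      fun t ht => (eqOn_logDeriv_eval_mul_derivWithin Q hab hg
        (Set.uIoc_subset_uIcc ht)).symm).const_mul c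

theorem re_integral_mul_logDeriv_eval_eq_zero {c : ℝ} (hab : a < b)
    (hg : ContDiffOn ℝ 1 g (Set.Icc a b)) (hgab : g a = g b)
    (hQ : c = 0 ∨ ∀ t ∈ Set.Icc a b, Q.eval (g t) ≠ 0) :
    (∫ t in a..b,
      c * (logDeriv (fun v => Q.eval v) (g t) * derivWithin g (Set.Icc a b) t)).re = 0 := by
  rw [intervalIntegral.integral_const_mul, Complex.re_ofReal_mul, mul_eq_zero]
  refine hQ.imp_right fun hQ => ?_
  rw [intervalIntegral.integral_congr (eqOn_logDeriv_eval_mul_derivWithin Q hab hg),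
    re_integral_derivWithin_div hab (contDiffOn_eval_comp Q hg) hQ, hgab, sub_self]

end PolynomialPath

namespace RiemannSphere

theorem coe_finiteChart {x : OnePoint ℂ} (hx : x ≠ OnePoint.infty) :
    (finiteChart x : OnePoint ℂ) = x := by
  obtain ⟨z, rfl⟩ := OnePoint.ne_infty_iff_exists.1 hx
  rw [finiteChart_coe]

theorem coe_extChartAt {x : OnePoint ℂ} (hx : x ≠ OnePoint.infty) :
    ⇑(extChartAt 𝓘(ℝ, ℂ) x) = finiteChart := by
  obtain ⟨z, rfl⟩ := OnePoint.ne_infty_iff_exists.1 hx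
  rw [extChartAt_coe, modelWithCornersSelf_coe, Function.id_comp, chartAt_coe]

theorem contDiffOn_finiteChart_comp {γ : ℝ → OnePoint ℂ} {s : Set ℝ}
    (hγ : ContMDiffOn 𝓘(ℝ, ℝ) 𝓘(ℝ, ℂ) 1 γ s) (hs : ∀ t ∈ s, γ t ≠ OnePoint.infty) :
    ContDiffOn ℝ 1 (fun t => finiteChart (γ t)) s := by
  intro t ht
  have hwritten := (contMDiffWithinAt_iff.1 (hγ t ht)).2
  rw [coe_extChartAt (hs t ht)] at hwritten
  have hchart : ContDiffWithinAt ℝ 1 (fun t => finiteChart (γ t))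
      (id ⁻¹' s ∩ Set.range id) t := hwritten
  simpa only [Set.preimage_id, Set.range_id, Set.inter_univ] using hchart

theorem mfderivWithin_apply_one {γ : ℝ → OnePoint ℂ} {s : Set ℝ} {t : ℝ}
    (hγ : MDifferentiableWithinAt 𝓘(ℝ, ℝ) 𝓘(ℝ, ℂ) γ s t) (ht : γ t ≠ OnePoint.infty) :
    (show ℂ from mfderivWithin 𝓘(ℝ, ℝ) 𝓘(ℝ, ℂ) γ s t (1 : ℝ)) =
      derivWithin (fun r => finiteChart (γ r)) s t := by
  have hwritten : writtenInExtChartAt 𝓘(ℝ, ℝ) 𝓘(ℝ, ℂ) t γ = fun r => finiteChart (γ r) := by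
    rw [writtenInExtChartAt, coe_extChartAt ht]
    rfl
  have hmfderiv : mfderivWithin 𝓘(ℝ, ℝ) 𝓘(ℝ, ℂ) γ s t =
      fderivWithin ℝ (writtenInExtChartAt 𝓘(ℝ, ℝ) 𝓘(ℝ, ℂ) t γ) (id ⁻¹' s ∩ Set.range id) t :=
    if_pos hγ
  rw [hwritten, Set.preimage_id, Set.range_id, Set.inter_univ] at hmfderiv
  exact DFunLike.congr_fun hmfderiv (1 : ℝ)

end RiemannSphere

section Periods

open RiemannSphere

variable {P : ℂ[X]} {α : ℝ}

theorem continuousAt_logDeriv_eval {Q : ℂ[X]} {u : ℂ} (hu : Q.eval u ≠ 0) :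
    ContinuousAt (logDeriv fun v => Q.eval v) u := by
  have hlog : (logDeriv fun v => Q.eval v) = fun v => (derivative Q).eval v / Q.eval v :=
    funext fun v => by rw [logDeriv_apply, Polynomial.deriv]
  rw [hlog]
  exact (derivative Q).continuous.continuousAt.div Q.continuous.continuousAt hu

theorem formValue_symbolParam_coe (hd : P.natDegree ≠ 0) (hα : α ≠ 0) {u : ℂ}
    (hu : α = 1 ∨ P.eval u ≠ 0) (hu' : (derivative P).eval u ≠ 0) :
    formValue (symbolParam P α) (u : OnePoint ℂ) = symbolForm P α u := by
  have hcont : ContinuousAt (symbolForm P α) u := by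
    refine ContinuousAt.add ?_ (continuousAt_logDeriv_eval hu')
    rcases hu with rfl | hu
    · simpa only [Complex.ofReal_one, sub_self, zero_div, zero_mul] using continuousAt_const
    · exact continuousAt_const.mul (continuousAt_logDeriv_eval hu)
  rw [formValue, chartAt_coe, finiteChart_coe]
  exact ((hcont.tendsto.mono_left nhdsWithin_le_nhds).congr'
    (eventuallyEq_formCoeff_symbolParam_coe hd hα u).symm).limUnder_eq

theorem eval_ne_zero_of_formOrder_symbolParam_nonneg (hd : P.natDegree ≠ 0) (hP : P.Separable)
    (hP' : (derivative P).Separable) (hα : α ≠ 0) (hαd : α ≠ P.natDegree) {p : OnePoint ℂ}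
    (hp : 0 ≤ formOrder (symbolParam P α) p) :
    p ≠ OnePoint.infty ∧ (α = 1 ∨ P.eval (finiteChart p) ≠ 0) ∧
      (derivative P).eval (finiteChart p) ≠ 0 := by
  rw [← not_lt, formOrder_symbolParam_neg_iff hd hP hP' hα hαd, not_or,
    symbolParam_eq_infty_zero_iff hP hα, not_or, not_and_or, not_not] at hp
  obtain ⟨⟨hp_infty, hp_crit⟩, hp_root⟩ := hp
  obtain ⟨u, rfl⟩ := OnePoint.ne_infty_iff_exists.1 hp_infty
  rw [finiteChart_coe]
  exact ⟨hp_infty, hp_root.imp_right fun h hu => h ⟨u, hu, symbolParam_coe_of_eval_eq_zero hP α hu⟩,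
    fun hu => hp_crit ⟨u, hu, rfl⟩⟩

theorem hasImaginaryPeriods_symbolParam (hd : P.natDegree ≠ 0) (hP : P.Separable)
    (hP' : (derivative P).Separable) (hα : α ≠ 0) (hαd : α ≠ P.natDegree) :
    HasImaginaryPeriods (symbolParam P α) := by
  intro γ hγ hclosed hpole
  have hreg t ht := eval_ne_zero_of_formOrder_symbolParam_nonneg hd hP hP' hα hαd (hpole t ht)
  set g : ℝ → ℂ := fun t => finiteChart (γ t)
  set g' := derivWithin g (Set.Icc 0 1)
  set c : ℝ := (1 - α) / α with hc_def
  have hg : ContDiffOn ℝ 1 g (Set.Icc 0 1) :=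
    contDiffOn_finiteChart_comp hγ fun t ht => (hreg t ht).1
  have hg01 : g 0 = g 1 := congrArg finiteChart hclosed
  have hroot : c = 0 ∨ ∀ t ∈ Set.Icc (0 : ℝ) 1, P.eval (g t) ≠ 0 := by
    refine (eq_or_ne α 1).imp (fun h => ?_) fun h t ht => (hreg t ht).2.1.resolve_left h
    rw [hc_def, h, sub_self, zero_div]
  have hcrit : (1 : ℝ) = 0 ∨ ∀ t ∈ Set.Icc (0 : ℝ) 1, (derivative P).eval (g t) ≠ 0 :=
    Or.inr fun t ht => (hreg t ht).2.2
  have hform : formIntegral (symbolParam P α) γ = ∫ t in (0 : ℝ)..1,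
      ((c : ℂ) * (logDeriv (fun v => P.eval v) (g t) * g' t) +
        ((1 : ℝ) : ℂ) * (logDeriv (fun v => (derivative P).eval v) (g t) * g' t)) := by
    refine intervalIntegral.integral_congr fun t ht => ?_
    rw [Set.uIcc_of_le zero_le_one] at ht
    obtain ⟨ht_infty, ht_root, ht_crit⟩ := hreg t ht
    rw [mfderivWithin_apply_one ((hγ t ht).mdifferentiableWithinAt one_ne_zero) ht_infty,
      ← coe_finiteChart ht_infty, formValue_symbolParam_coe hd hα ht_root ht_crit, symbolForm]
    push_cast [hc_def]
    ring
  rw [hform, intervalIntegral.integral_add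
    (intervalIntegrable_mul_logDeriv_eval zero_lt_one hg (hroot.imp_left Complex.ofReal_eq_zero.2))
    (intervalIntegrable_mul_logDeriv_eval zero_lt_one hg (hcrit.imp_left Complex.ofReal_eq_zero.2)),
    Complex.add_re, re_integral_mul_logDeriv_eval_eq_zero zero_lt_one hg hg01 hroot,
    re_integral_mul_logDeriv_eval_eq_zero zero_lt_one hg hg01 hcrit, add_zero]

theorem isAffineBoutroux_scaledSymbol (hd : P.natDegree ≠ 0) (hP : P.Separable)
    (hP' : (derivative P).Separable) (hα : α ≠ 0) (hαd : α ≠ P.natDegree) :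
    IsAffineBoutroux (scaledSymbol P α) :=
  ⟨irreducible_scaledSymbol hd hP hα hαd, _, _, _, symbolParam P α,
    isNormalisation_symbolParam hd hP hα hαd, hasImaginaryPeriods_symbolParam hd hP hP' hα hαd⟩

end Periods

/-! ### Fibres of the normalisation -/

theorem StronglyGeneric.separable {P : ℂ[X]} (hP : StronglyGeneric P) (hP₀ : P ≠ 0) :
    P.Separable :=
  (nodup_roots_iff_of_splits hP₀ (IsAlgClosed.splits P)).1 hP.1

theorem StronglyGeneric.separable_derivative {P : ℂ[X]} (hP : StronglyGeneric P)
    (hP₀ : derivative P ≠ 0) : (derivative P).Separable :=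
  (nodup_roots_iff_of_splits hP₀ (IsAlgClosed.splits _)).1 hP.2

theorem ncard_setOf_eval_eq_zero {K : Type*} [Field K] [IsAlgClosed K] {Q : K[X]}
    (hQ : Q.Separable) : {u : K | Q.eval u = 0}.ncard = Q.natDegree := by
  have hroots : {u : K | Q.eval u = 0} = Q.rootSet K := by
    ext u
    rw [Set.mem_ofPred_eq, mem_rootSet_of_ne hQ.ne_zero, coe_aeval_eq_eval]
  rw [hroots, ← Nat.card_coe_set_eq, Nat.card_eq_fintype_card,
    card_rootSet_eq_natDegree hQ (IsAlgClosed.splits _)]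

section Fibres

variable {P : ℂ[X]} {α : ℝ}

theorem ncard_setOf_symbolParam_eq_infty_zero (hd : P.natDegree ≠ 0) (hP : P.Separable)
    (hP' : (derivative P).Separable) (hα : α ≠ 0) :
    {p | symbolParam P α p = (OnePoint.infty, ((0 : ℂ) : OnePoint ℂ))}.ncard = P.natDegree := by
  have hfin : {u : ℂ | (derivative P).eval u = 0}.Finite := finite_setOfPred_isRoot hP'.ne_zero
  rw [setOf_symbolParam_eq_infty_zero hP hα, Set.ncard_insert_of_notMem (by simp) (hfin.image _),
    Set.ncard_image_of_injective _ OnePoint.coe_injective, ncard_setOf_eval_eq_zero hP',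
    natDegree_derivative, Nat.sub_add_cancel (Nat.one_le_iff_ne_zero.2 hd)]

theorem ncard_setOf_symbolParam_eq_coe_infty (hP : P.Separable) (hα : α ≠ 0) :
    {p | ∃ z : ℂ, P.IsRoot z ∧ symbolParam P α p = ((z : OnePoint ℂ), OnePoint.infty)}.ncard =
      P.natDegree := by
  have himage : {p | ∃ z : ℂ, P.IsRoot z ∧ symbolParam P α p = ((z : OnePoint ℂ), OnePoint.infty)} =
      (↑) '' {u : ℂ | P.eval u = 0} :=
    Set.ext fun p => exists_congr fun z => and_congr_right fun hz =>
      (symbolParam_eq_coe_infty_iff hP hα hz).trans eq_comm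
  rw [himage, Set.ncard_image_of_injective _ OnePoint.coe_injective, ncard_setOf_eval_eq_zero hP]

theorem existsUnique_symbolParam_eq_coe_infty (hP : P.Separable) (hα : α ≠ 0) {z : ℂ}
    (hz : P.eval z = 0) : ∃! p, symbolParam P α p = ((z : OnePoint ℂ), OnePoint.infty) :=
  ⟨z, symbolParam_coe_of_eval_eq_zero hP α hz, fun _ => (symbolParam_eq_coe_infty_iff hP hα hz).1⟩

theorem isSmoothBranchAtInfty_and_hasFormResidue_of_ne_infty (hd : P.natDegree ≠ 0)
    (hP : P.Separable) (hP' : (derivative P).Separable) (hα : α ≠ 0) {p : OnePoint ℂ}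
    (hp : symbolParam P α p = (OnePoint.infty, ((0 : ℂ) : OnePoint ℂ)))
    (hp_infty : p ≠ OnePoint.infty) :
    IsSmoothBranchAtInfty (symbolParam P α) p (-1) ∧ HasFormResidue (symbolParam P α) p 1 := by
  obtain ⟨u, hu, rfl⟩ := ((symbolParam_eq_infty_zero_iff hP hα).1 hp).resolve_left hp_infty
  have hres := hasFormResidue_symbolParam hd hα (u : OnePoint ℂ)
  rw [symbolResidue_coe_of_eval_derivative_eq_zero hP hP' α hu] at hres
  exact ⟨isSmoothBranchAtInfty_symbolParam_coe hP hP' hα hu, hres⟩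

end Fibres

theorem mainTheorem4_general (P : ℂ[X]) (d : ℕ) (α : ℝ) (hdeg : P.natDegree = d) (hd : 2 ≤ d)
    (hP : StronglyGeneric P) (hα : α ≠ 0) (hαd : α ≠ d) :
    IsAffineBoutroux (scaledSymbol P α) ∧
    Irreducible (scaledSymbol P α) ∧
    IsRationalCurve (scaledSymbol P α) ∧
    {p ∈ curveClosure (scaledSymbol P α) | p.1 = OnePoint.infty} =
      {(OnePoint.infty, ((0 : ℂ) : OnePoint ℂ))} ∧
    (∃ c : ℂ, c ≠ 0 ∧
      HasSlopePolynomial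
        (localEquation (scaledSymbol P α) (OnePoint.infty, ((0 : ℂ) : OnePoint ℂ))) d
        (C c * ((X + 1) ^ (d - 1) * (C (α : ℂ) * (X + 1) - C (d : ℂ))))) ∧
    ((X + 1) ^ (d - 1) * (C (α : ℂ) * (X + 1) - C (d : ℂ)) : ℂ[X]).roots =
      ((d : ℂ) / α - 1) ::ₘ Multiset.replicate (d - 1) (-1) ∧
    (d : ℂ) / α - 1 ≠ -1 ∧
    singularPoints (scaledSymbol P α) = {(OnePoint.infty, ((0 : ℂ) : OnePoint ℂ))} ∧
    ∃ ν : OnePoint ℂ → SphereSq,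
      IsNormalisation (scaledSymbol P α) ν ∧
      HasImaginaryPeriods ν ∧
      (∀ x ∈ curveClosure (scaledSymbol P α),
        x ≠ (OnePoint.infty, ((0 : ℂ) : OnePoint ℂ)) → ∃! p, ν p = x) ∧
      {p | ν p = (OnePoint.infty, ((0 : ℂ) : OnePoint ℂ))}.ncard = d ∧
      (∀ p, MeromorphicAt (formCoeff ν p) (chartAt ℂ p p)) ∧
      (∀ p, formOrder ν p < 0 ↔
        ν p = (OnePoint.infty, ((0 : ℂ) : OnePoint ℂ)) ∨
          (α ≠ 1 ∧ ∃ z : ℂ, P.IsRoot z ∧ ν p = ((z : OnePoint ℂ), OnePoint.infty))) ∧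
      (∀ p, formOrder ν p < 0 → formOrder ν p = ((-1 : ℤ) : WithTop ℤ)) ∧
      {p | ∃ z : ℂ, P.IsRoot z ∧ ν p = ((z : OnePoint ℂ), OnePoint.infty)}.ncard = d ∧
      (∀ z : ℂ, P.IsRoot z → ∃! p, ν p = ((z : OnePoint ℂ), OnePoint.infty)) ∧
      (∀ z : ℂ, P.IsRoot z → ∀ p, ν p = ((z : OnePoint ℂ), OnePoint.infty) →
        HasFormResidue ν p ((1 - α) / α)) ∧
      ∃ p₀, ν p₀ = (OnePoint.infty, ((0 : ℂ) : OnePoint ℂ)) ∧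
        IsSmoothBranchAtInfty ν p₀ ((d : ℂ) / α - 1) ∧
        HasFormResidue ν p₀ ((α - d) / α) ∧
        ∀ p, ν p = (OnePoint.infty, ((0 : ℂ) : OnePoint ℂ)) → p ≠ p₀ →
          IsSmoothBranchAtInfty ν p (-1) ∧ HasFormResidue ν p 1 := by
  subst hdeg
  have hd₀ : P.natDegree ≠ 0 := by lia
  have hsep := hP.separable (ne_zero_of_natDegree_gt hd)
  have hsep' := hP.separable_derivative (derivative_eq_zero.not.2 hd₀)
  have hslope : (P.natDegree : ℂ) / α - 1 ≠ -1 := sub_eq_neg_self.not.2 <|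
    div_ne_zero (Nat.cast_ne_zero.2 hd₀) (Complex.ofReal_ne_zero.2 hα)
  exact ⟨isAffineBoutroux_scaledSymbol hd₀ hsep hsep' hα hαd,
    irreducible_scaledSymbol hd₀ hsep hα hαd, isRationalCurve_scaledSymbol hd₀ hsep hα hαd,
    setOf_mem_curveClosure_scaledSymbol_fst_eq_infty hd₀ hsep hα hαd,
    ⟨P.leadingCoeff, leadingCoeff_ne_zero.2 hsep.ne_zero, hasSlopePolynomial_scaledSymbol hd₀ hα⟩,
    roots_X_add_one_pow_mul_C_mul_X_add_one_sub_C (Complex.ofReal_ne_zero.2 hα) _ _, hslope,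
    singularPoints_scaledSymbol hd hsep hα hαd, symbolParam P α,
    isNormalisation_symbolParam hd₀ hsep hα hαd,
    hasImaginaryPeriods_symbolParam hd₀ hsep hsep' hα hαd,
    fun _ => existsUnique_symbolParam_eq hd₀ hsep hα hαd,
    ncard_setOf_symbolParam_eq_infty_zero hd₀ hsep hsep' hα,
    meromorphicAt_formCoeff_symbolParam hd₀ hα,
    fun _ => formOrder_symbolParam_neg_iff hd₀ hsep hsep' hα hαd,
    fun _ => formOrder_symbolParam_eq_neg_one hd₀ hα,
    ncard_setOf_symbolParam_eq_coe_infty hsep hα,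
    fun _ => existsUnique_symbolParam_eq_coe_infty hsep hα,
    fun _ hz _ => hasFormResidue_of_symbolParam_eq_coe_infty hd₀ hsep hα hz,
    OnePoint.infty, symbolParam_infty P α, isSmoothBranchAtInfty_symbolParam_infty hd₀ hα hαd,
    hasFormResidue_symbolParam hd₀ hα OnePoint.infty,
    fun _ => isSmoothBranchAtInfty_and_hasFormResidue_of_ne_infty hd₀ hsep hsep' hα⟩

theorem mainTheorem4 (P : ℂ[X]) (d : ℕ) (α : ℝ) (hdeg : P.natDegree = d) (hd : 2 ≤ d)
    (hP : StronglyGeneric P) (hα₀ : 0 < α) (hα₁ : α < d) :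
    -- the curve is an affine Boutroux curve, irreducible and rational
    IsAffineBoutroux (scaledSymbol P α) ∧
    Irreducible (scaledSymbol P α) ∧
    IsRationalCurve (scaledSymbol P α) ∧
    -- the fibre of the closure over `z = ∞`
    {p ∈ curveClosure (scaledSymbol P α) | p.1 = OnePoint.infty} =
      {(OnePoint.infty, ((0 : ℂ) : OnePoint ℂ))} ∧
    -- the equation of the slopes at `(∞, 0)` and its solutions with multiplicities
    (∃ c : ℂ, c ≠ 0 ∧
      HasSlopePolynomial
        (localEquation (scaledSymbol P α) (OnePoint.infty, ((0 : ℂ) : OnePoint ℂ))) d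
        (C c * ((X + 1) ^ (d - 1) * (C (α : ℂ) * (X + 1) - C (d : ℂ))))) ∧
    ((X + 1) ^ (d - 1) * (C (α : ℂ) * (X + 1) - C (d : ℂ)) : ℂ[X]).roots =
      ((d : ℂ) / α - 1) ::ₘ Multiset.replicate (d - 1) (-1) ∧
    (d : ℂ) / α - 1 ≠ -1 ∧
    -- the only singular point
    singularPoints (scaledSymbol P α) = {(OnePoint.infty, ((0 : ℂ) : OnePoint ℂ))} ∧
    -- the normalisation is the Riemann sphere
    ∃ ν : OnePoint ℂ → SphereSq,
      IsNormalisation (scaledSymbol P α) ν ∧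
      HasImaginaryPeriods ν ∧
      (∀ x ∈ curveClosure (scaledSymbol P α),
        x ≠ (OnePoint.infty, ((0 : ℂ) : OnePoint ℂ)) → ∃! p, ν p = x) ∧
      {p | ν p = (OnePoint.infty, ((0 : ℂ) : OnePoint ℂ))}.ncard = d ∧
      -- the poles of `w dz` are the points over `(∞, 0)` and, unless `α = 1`, the points over
      -- `(zᵢ, ∞)` with `zᵢ` a root of `P`; all of them are simple
      (∀ p, MeromorphicAt (formCoeff ν p) (chartAt ℂ p p)) ∧
      (∀ p, formOrder ν p < 0 ↔
        ν p = (OnePoint.infty, ((0 : ℂ) : OnePoint ℂ)) ∨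
          (α ≠ 1 ∧ ∃ z : ℂ, P.IsRoot z ∧ ν p = ((z : OnePoint ℂ), OnePoint.infty))) ∧
      (∀ p, formOrder ν p < 0 → formOrder ν p = ((-1 : ℤ) : WithTop ℤ)) ∧
      -- the `d` points over the roots of `P`
      {p | ∃ z : ℂ, P.IsRoot z ∧ ν p = ((z : OnePoint ℂ), OnePoint.infty)}.ncard = d ∧
      (∀ z : ℂ, P.IsRoot z → ∃! p, ν p = ((z : OnePoint ℂ), OnePoint.infty)) ∧
      (∀ z : ℂ, P.IsRoot z → ∀ p, ν p = ((z : OnePoint ℂ), OnePoint.infty) →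
        HasFormResidue ν p ((1 - α) / α)) ∧
      -- the `d` branches at `(∞, 0)`
      ∃ p₀, ν p₀ = (OnePoint.infty, ((0 : ℂ) : OnePoint ℂ)) ∧
        IsSmoothBranchAtInfty ν p₀ ((d : ℂ) / α - 1) ∧
        HasFormResidue ν p₀ ((α - d) / α) ∧
        ∀ p, ν p = (OnePoint.infty, ((0 : ℂ) : OnePoint ℂ)) → p ≠ p₀ →
          IsSmoothBranchAtInfty ν p (-1) ∧ HasFormResidue ν p 1 :=
  mainTheorem4_general P d α hdeg hd hP hα₀.ne' hα₁.ne
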